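/- Let $G=(V,E)$ be a finite, simple, connected graph, and let $N\ge 1$. For $\beta\ge 0$ let $\mu_{G,N,\beta}$ be the spin $O(N)$ model on $G$, i.e. the probability measure on $(\mathbb{S}^{N-1})^V$ proportional to $\exp\big(\beta\sum_{\{i,j\}\in E}\sigma_i\cdot\sigma_j\big)\,d\sigma$, where $d\sigma$ is the product of the Lebesgue (surface) measures on the unit sphere $\mathbb{S}^{N-1}\subset\mathbb{R}^N$ (counting measure on $\{\pm1\}$ if $N=1$). For $h\in(\mathbb{R}^N)^V$ put $$Z^*_{G,N,\beta}(h)=\int_{(\mathbb{S}^{N-1})^V}\exp\Big(-\frac{\beta}{2}\sum_{\{i,j\}\in E}\|\sigma_i+h_i-\sigma_j-h_j\|^2\Big)\,d\sigma .$$ This is a twice continuously differentiable function of $h$; for $v\in(\mathbb{R}^N)^V$ write $Z_v(\eta)=Z^*_{G,N,\beta}(\eta v)$, $\eta\in\mathbb{R}$. Then: 1. There is $\beta_d=\beta_d(N,G)>0$ such that for every $\beta>\beta_d$ Gaussian domination holds, i.e. $Z^*_{G,N,\beta}$ has a local maximum at $h=0$; moreover, $Z_v''(0)<0$ for every $\beta>\beta_d$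 and every $v$ whose components $v_x$, $x\in V$, are not all equal. 2. For all $l\in\{1,\dots,N\}$ and $x,y\in V$, $$\lim_{\beta\to\infty}\beta\,\mathbb{E}_{\mu_{G,N,\beta}}\big[\Delta\sigma_x^l\,\Delta\sigma_y^l\big]=\frac{N-1}{N}\,L_{xy},$$ where $\Delta\sigma_x^l=\sum_{z:\{x,z\}\in E}(\sigma_x^l-\sigma_z^l)$ and $L$ is the graph Laplacian matrix: $L_{xx}=d(x)$ is the degree of $x$, $L_{xy}=-1$ if $\{x,y\}\in E$, and $L_{xy}=0$ otherwise. 3. For every vertex $o\in V$, as $\beta\to\infty$, $$\frac{Z_v''(0)}{\beta\,Z^*_{G,N,\beta}(0)}\longrightarrow-\frac1N\sum_{\{i,j\}\in E}\|v_i-v_j\|^2$$ uniformly over the normalized directions $v\in(\mathbb{R}^N)^V$ with $v_o=0$ and $\sum_{x\in V}\|v_x\|^2=1$, and the limit is strictly negative for each such $v$. -/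

import Mathlib

open MeasureTheory Filter Topology

noncomputable section

namespace SpinON

/-- The spin space: the unit sphere of Euclidean `ℝ^N`. -/
abbrev Spin (N : ℕ) : Type := Metric.sphere (0 : EuclideanSpace ℝ (Fin N)) 1

/-- The Lebesgue (surface) measure on the unit sphere of `ℝ^N`; for `N = 1` this is the counting
measure on the two points `1` and `-1`. -/
def surfaceMeasure (N : ℕ) : Measure (Spin N) :=
  (volume : Measure (EuclideanSpace ℝ (Fin N))).toSphere

instance (N : ℕ) : IsFiniteMeasure (surfaceMeasure N) := by
  unfold surfaceMeasure
  infer_instance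

variable {V : Type*} [Fintype V] [DecidableEq V]

/-- The product measure `dσ` on spin configurations. -/
def configMeasure (V : Type*) [Fintype V] (N : ℕ) : Measure (V → Spin N) :=
  Measure.pi fun _ => surfaceMeasure N

/-- The sum over the (unordered) edges `{i, j}` of `G` of a symmetric function `f i j`. -/
def edgeSum (G : SimpleGraph V) [DecidableRel G.Adj] (f : V → V → ℝ)
    (hf : ∀ i j, f i j = f j i) : ℝ :=
  ∑ e ∈ G.edgeFinset, Sym2.lift ⟨f, hf⟩ e

/-- The Dirichlet energy: the sum of `‖v_i - v_j‖ ^ 2` over the edges `{i, j}` of `G`. -/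
def energy (G : SimpleGraph V) [DecidableRel G.Adj] {N : ℕ}
    (v : V → EuclideanSpace ℝ (Fin N)) : ℝ :=
  edgeSum G (fun i j => ‖v i - v j‖ ^ 2) (fun i j => by rw [norm_sub_rev])

/-- The Hamiltonian `H(σ) = - ∑ σ_i · σ_j`, the sum being over the edges `{i, j}` of `G`. -/
def hamiltonian (G : SimpleGraph V) [DecidableRel G.Adj] {N : ℕ} (σ : V → Spin N) : ℝ :=
  -edgeSum G (fun i j => inner ℝ (σ i : EuclideanSpace ℝ (Fin N)) (σ j))
    (fun _ _ => real_inner_comm _ _)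

/-- The spin `O(N)` model on `G` at inverse temperature `β`: the probability measure proportional
to `exp (-β H(σ)) dσ`. -/
def gibbsMeasure (G : SimpleGraph V) [DecidableRel G.Adj] (N : ℕ) (β : ℝ) :
    Measure (V → Spin N) :=
  (configMeasure V N).tilted fun σ => -β * hamiltonian G σ

/-- The modified partition function
`Z*(h) = ∫ exp (-(β / 2) ∑ ‖σ_i + h_i - σ_j - h_j‖ ^ 2) dσ`, the sum being over the edges. -/
def modifiedPartition (G : SimpleGraph V) [DecidableRel G.Adj] (N : ℕ) (β : ℝ)
    (h : V → EuclideanSpace ℝ (Fin N)) : ℝ :=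
  ∫ σ, Real.exp (-(β / 2) * energy G (fun i => (σ i : EuclideanSpace ℝ (Fin N)) + h i))
    ∂(configMeasure V N)

/-- (Local) Gaussian domination: the modified partition function has a local maximum at `0`. -/
def GaussianDomination (G : SimpleGraph V) [DecidableRel G.Adj] (N : ℕ) (β : ℝ) : Prop :=
  IsLocalMax (modifiedPartition G N β) 0

/-- The second derivative at `η = 0` of `Z_v(η) = Z*(η v)`. -/
def secondDeriv (G : SimpleGraph V) [DecidableRel G.Adj] (N : ℕ) (β : ℝ)
    (v : V → EuclideanSpace ℝ (Fin N)) : ℝ :=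
  iteratedDeriv 2 (fun η : ℝ => modifiedPartition G N β (η • v)) 0

/-- The graph Laplacian of the `l`-th spin component at the vertex `x`:
the sum of `σ_x^l - σ_z^l` over the neighbours `z` of `x`. -/
def spinLaplacian (G : SimpleGraph V) [DecidableRel G.Adj] {N : ℕ} (σ : V → Spin N)
    (x : V) (l : Fin N) : ℝ :=
  ∑ z ∈ G.neighborFinset x,
    ((σ x : EuclideanSpace ℝ (Fin N)) l - (σ z : EuclideanSpace ℝ (Fin N)) l)

/-- The normalized directions: `v_o = 0` at the base vertex `o` and `∑ ‖v_x‖ ^ 2 = 1`. -/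
def normalizedDirections (N : ℕ) (o : V) : Set (V → EuclideanSpace ℝ (Fin N)) :=
  {v | v o = 0 ∧ ∑ x, ‖v x‖ ^ 2 = 1}

end SpinON

end

/-! Rotating one spin `σ_x` leaves `dσ` invariant. Differentiating this invariance in every
coordinate plane and summing gives an exact Schwinger–Dyson equation (`integral_schwinger_dyson`),
which in the Gibbs measure reads β E[Δσ_x · Δσ_y] = (N - 1)(L_xy - E[σ_x · Δσ_y]) + β E[(σ_x ·
Δσ_x)(σ_x · Δσ_y)]. The term (N - 1) L_xy is the limit and the others are errors. Since spins have
norm one, σ_x · Δσ_x is half a sum of squared differences, hence at most the Dirichlet energy.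

The errors vanish once the energy is known to be O(1/β) in mean. Take x = y and sum over x: on a
connected graph the energy is at most a constant times Σ ‖Δσ_x‖²
(`exists_energy_le_sum_norm_lap_sq`), while the mean squared energy is at most ε times the mean
energy plus an exponentially small term (`exists_integral_energy_sq_le`), so it can be absorbed for
small ε. Global reflections and coordinate swaps then turn the limit of the trace into the limit of
each component.

The second derivative of Z* in the direction v is β Z*(0) (β E[D(σ, v)²] - energy v), where D is the
Dirichlet form (`secondDeriv_eq`). The covariance term tends to ((N - 1)/N) energy v, which leaves
-(1/N) energy v. As Z* is invariant under constant shifts, its Hessian is degenerate, and negative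
second derivatives alone do not yield a local maximum. Instead Z*(h)/Z*(0) is written as a Gaussian
factor times the mean of a cosh, with every error measured relative to energy h. -/

noncomputable section

namespace SpinON

set_option linter.unusedSectionVars false

/-! ### Integrals depending on a parameter over a compact space. -/

section ParametricIntegrals

variable {X : Type*} [TopologicalSpace X] [CompactSpace X] [MeasurableSpace X]
  [OpensMeasurableSpace X] (μ : Measure X) [IsFiniteMeasure μ]

theorem integrable_of_continuous {f : X → ℝ} (hf : Continuous f) : Integrable f μ :=
  BoundedContinuousFunction.integrable μ (BoundedContinuousFunction.mkOfCompact ⟨f, hf⟩)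

/-- Integration of continuous functions on a compact space as a continuous linear form. -/
def integralForm : C(X, ℝ) →L[ℝ] ℝ :=
  LinearMap.mkContinuous
    { toFun := fun f => ∫ x, f x ∂μ
      map_add' := fun f g => by
        simpa using integral_add (integrable_of_continuous μ f.continuous)
          (integrable_of_continuous μ g.continuous)
      map_smul' := fun c f => by simp [integral_const_mul] }
    (μ.real Set.univ) fun f => by
      rw [mul_comm]
      exact norm_integral_le_of_norm_le_const (Eventually.of_forall fun x => f.norm_coe_le_norm x)

/-- In the Banach algebra `C(X, ℝ)` the exponential is analytic and integration is a continuous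
linear form; evaluation at a point commutes with the exponential. No differentiation under the
integral is needed. -/
theorem contDiff_integral_exp {H : Type*} [NormedAddCommGroup H] [NormedSpace ℝ H]
    {n : WithTop ℕ∞} {Q : H → C(X, ℝ)} (hQ : ContDiff ℝ n Q) :
    ContDiff ℝ n fun h => ∫ x, Real.exp (Q h x) ∂μ := by
  have hexp : ContDiff ℝ n (NormedSpace.exp : C(X, ℝ) → C(X, ℝ)) :=
    AnalyticOnNhd.contDiff fun f _ => NormedSpace.exp_analytic (𝕂 := ℝ) f
  have h1 : ContDiff ℝ n fun h => integralForm μ (NormedSpace.exp (Q h)) :=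
    (integralForm μ).contDiff.comp (hexp.comp hQ)
  convert h1 using 2 with h
  refine integral_congr_ae (Eventually.of_forall fun x => ?_)
  have := NormedSpace.map_exp (ContinuousMap.evalAlgHom ℝ ℝ x)
    (continuous_eval_const x) (Q h)
  simp only [Real.exp_eq_exp_ℝ]
  exact this.symm

/-- By compactness `F'` is bounded on a unit ball around `t` times `X`, so a constant dominates. -/
theorem hasDerivAt_integral_of_continuous {F F' : ℝ → X → ℝ}
    (hF : Continuous (Function.uncurry F)) (hF' : Continuous (Function.uncurry F'))
    (h : ∀ t x, HasDerivAt (fun s => F s x) (F' t x) t) (t : ℝ) :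
    HasDerivAt (fun s => ∫ x, F s x ∂μ) (∫ x, F' t x ∂μ) t := by
  obtain ⟨C, hC⟩ := ((isCompact_closedBall t 1).prod
    (isCompact_univ (X := X))).exists_bound_of_continuousOn hF'.continuousOn
  refine (hasDerivAt_integral_of_dominated_loc_of_deriv_le (bound := fun _ => C)
    (Metric.ball_mem_nhds t one_pos) ?_ ?_ ?_ ?_ (integrable_const C) ?_).2
  · refine Eventually.of_forall fun s => ?_
    exact (integrable_of_continuous μ (hF.comp (Continuous.prodMk_right s))).aestronglyMeasurable
  · exact integrable_of_continuous μ (hF.comp (Continuous.prodMk_right t))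
  · exact (integrable_of_continuous μ (hF'.comp (Continuous.prodMk_right t))).aestronglyMeasurable
  · refine Eventually.of_forall fun x s hs => ?_
    exact hC (s, x) ⟨Metric.ball_subset_closedBall hs, Set.mem_univ _⟩
  · exact Eventually.of_forall fun x s _ => h s x

end ParametricIntegrals

/-! ### Invariance of the surface measure under linear isometries. -/

section Isometries

variable {N : ℕ}

/-- The action of a linear isometry of `ℝ^N` on the unit sphere. -/
def rotateSpin (R : EuclideanSpace ℝ (Fin N) ≃ₗᵢ[ℝ] EuclideanSpace ℝ (Fin N)) (s : Spin N) :
    Spin N :=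
  ⟨R s, by simp [mem_sphere_zero_iff_norm.1 s.2]⟩

theorem continuous_rotateSpin (R : EuclideanSpace ℝ (Fin N) ≃ₗᵢ[ℝ] EuclideanSpace ℝ (Fin N)) :
    Continuous (rotateSpin R) := by
  unfold rotateSpin
  exact (R.continuous.comp continuous_subtype_val).subtype_mk _

open scoped Pointwise in
-- The surface measure of a set is, up to a dimensional factor, the volume of the cone over it. The
-- cone over the preimage is the isometric preimage of the cone, and linear isometries preserve
-- volume.
theorem measurePreserving_rotateSpin
    (R : EuclideanSpace ℝ (Fin N) ≃ₗᵢ[ℝ] EuclideanSpace ℝ (Fin N)) :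
    MeasurePreserving (rotateSpin R) (surfaceMeasure N) (surfaceMeasure N) := by
  refine ⟨(continuous_rotateSpin R).measurable, ?_⟩
  ext s hs
  have hpre := (continuous_rotateSpin R).measurable hs
  rw [Measure.map_apply (continuous_rotateSpin R).measurable hs, surfaceMeasure,
    Measure.toSphere_apply' _ hs, Measure.toSphere_apply' _ hpre]
  congr 1
  have key : Set.Ioo (0 : ℝ) 1 • ((↑) '' (rotateSpin R ⁻¹' s) : Set (EuclideanSpace ℝ (Fin N)))
      = R.symm '' (Set.Ioo (0 : ℝ) 1 • ((↑) '' s : Set (EuclideanSpace ℝ (Fin N)))) := by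
    ext v
    simp only [Set.mem_smul, Set.mem_image, Set.mem_preimage]
    constructor
    · rintro ⟨c, hc, _, ⟨p, hp, rfl⟩, rfl⟩
      exact ⟨c • R p, ⟨c, hc, R p, ⟨rotateSpin R p, hp, rfl⟩, rfl⟩, by simp⟩
    · rintro ⟨_, ⟨c, hc, _, ⟨p, hp, rfl⟩, rfl⟩, rfl⟩
      refine ⟨c, hc, R.symm p, ⟨rotateSpin R.symm p, ?_, rfl⟩, by simp⟩
      have : rotateSpin R (rotateSpin R.symm p) = p := Subtype.ext (by simp [rotateSpin])
      rwa [this]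
  rw [key, R.symm.image_eq_preimage_symm]
  exact (R.measurePreserving).measure_preimage_emb R.toMeasurableEquiv.measurableEmbedding _

variable {V : Type*} [Fintype V]

theorem measurePreserving_rotateConfig
    (R : V → EuclideanSpace ℝ (Fin N) ≃ₗᵢ[ℝ] EuclideanSpace ℝ (Fin N)) :
    MeasurePreserving (fun (σ : V → Spin N) x => rotateSpin (R x) (σ x))
      (configMeasure V N) (configMeasure V N) :=
  measurePreserving_pi _ _ fun x => measurePreserving_rotateSpin (R x)

/-- The isometry may depend on the vertex: it is constant for the global symmetries, and the
identity away from one vertex for the integration by parts. -/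
theorem integral_rotateConfig
    (R : V → EuclideanSpace ℝ (Fin N) ≃ₗᵢ[ℝ] EuclideanSpace ℝ (Fin N))
    {f : (V → Spin N) → ℝ} (hf : Continuous f) :
    ∫ σ, f (fun x => rotateSpin (R x) (σ x)) ∂(configMeasure V N)
      = ∫ σ, f σ ∂(configMeasure V N) := by
  have h := measurePreserving_rotateConfig (V := V) R
  conv_rhs => rw [← h.map_eq]
  rw [integral_map h.measurable.aemeasurable hf.aestronglyMeasurable]

/-- The rotation by the angle `t` of the plane of the coordinates `a ≠ b`, as a function. -/
def planarMap (a b : Fin N) (t : ℝ) (v : EuclideanSpace ℝ (Fin N)) : EuclideanSpace ℝ (Fin N) :=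
  v + ((Real.cos t - 1) * v a - Real.sin t * v b) • EuclideanSpace.single a (1 : ℝ)
    + (Real.sin t * v a + (Real.cos t - 1) * v b) • EuclideanSpace.single b (1 : ℝ)

theorem norm_planarMap {a b : Fin N} (hab : a ≠ b) (t : ℝ) (v : EuclideanSpace ℝ (Fin N)) :
    ‖planarMap a b t v‖ = ‖v‖ := by
  rw [← sq_eq_sq₀ (norm_nonneg _) (norm_nonneg _), planarMap, norm_add_sq_real, norm_add_sq_real]
  simp only [inner_add_left, real_inner_smul_right,
    EuclideanSpace.inner_single_right, norm_smul, PiLp.norm_single, mul_pow,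
    Real.norm_eq_abs, sq_abs]
  simp [hab.symm]
  linear_combination ((v a) ^ 2 + (v b) ^ 2) * Real.sin_sq_add_cos_sq t

/-- The rotation by the angle `t` of the plane of the coordinates `a ≠ b`. -/
def planarRotation {a b : Fin N} (hab : a ≠ b) (t : ℝ) :
    EuclideanSpace ℝ (Fin N) ≃ₗᵢ[ℝ] EuclideanSpace ℝ (Fin N) :=
  LinearIsometry.toLinearIsometryEquiv
    { toFun := planarMap a b t
      map_add' := fun v w => by
        simp only [planarMap, PiLp.add_apply]
        module
      map_smul' := fun c v => by
        simp only [planarMap, PiLp.smul_apply, smul_eq_mul, RingHom.id_apply]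
        module
      norm_map' := norm_planarMap hab t } rfl

theorem planarRotation_apply {a b : Fin N} (hab : a ≠ b) (t : ℝ) (v : EuclideanSpace ℝ (Fin N)) :
    planarRotation hab t v = planarMap a b t v := rfl

end Isometries

/-! ### Discrete calculus on the graph: Laplacian, Dirichlet form, Poincaré inequality. -/

section GraphForms

variable {V : Type*} [Fintype V] [DecidableEq V] (G : SimpleGraph V) [DecidableRel G.Adj]

/-- Every edge carries exactly two darts. -/
theorem two_mul_edgeSum (f : V → V → ℝ) (hf : ∀ i j, f i j = f j i) :
    2 * edgeSum G f hf = ∑ x, ∑ z ∈ G.neighborFinset x, f x z := by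
  have h1 : ∑ d : G.Dart, f d.fst d.snd = 2 * edgeSum G f hf := by
    rw [edgeSum, Finset.mul_sum,
      ← Finset.sum_fiberwise_of_maps_to (s := Finset.univ) (t := G.edgeFinset)
        (g := SimpleGraph.Dart.edge) (fun d _ => by
          rw [SimpleGraph.mem_edgeFinset]; exact d.edge_mem)]
    refine Finset.sum_congr rfl fun e he => ?_
    rw [SimpleGraph.mem_edgeFinset] at he
    have : ∀ d ∈ Finset.univ.filter (fun d : G.Dart => d.edge = e),
        f d.fst d.snd = Sym2.lift ⟨f, hf⟩ e := by
      intro d hd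
      rw [← (Finset.mem_filter.1 hd).2]
      rfl
    rw [Finset.sum_congr rfl this, Finset.sum_const, G.dart_edge_fiber_card e he]
    simp
  rw [← h1, Finset.sum_sigma']
  symm
  refine Finset.sum_bij' (fun p hp => (⟨(p.1, p.2), by simpa using hp⟩ : G.Dart))
    (fun d _ => ⟨d.fst, d.snd⟩) ?_ ?_ ?_ ?_ ?_
  · intros; simp
  · intros; simp
  · intros; rfl
  · intros; rfl
  · intros; rfl

variable {N : ℕ}

/-- The graph Laplacian of a vector field on the vertices. -/
def lap (s : V → EuclideanSpace ℝ (Fin N)) (x : V) : EuclideanSpace ℝ (Fin N) :=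
  ∑ z ∈ G.neighborFinset x, (s x - s z)

/-- The Dirichlet form `∑ (s_i - s_j) · (w_i - w_j)`, summed by parts. -/
def dirichletForm (s w : V → EuclideanSpace ℝ (Fin N)) : ℝ := ∑ x, inner ℝ (w x) (lap G s x)

theorem lap_add (s w : V → EuclideanSpace ℝ (Fin N)) (x : V) :
    lap G (s + w) x = lap G s x + lap G w x := by
  simp only [lap, Pi.add_apply, ← Finset.sum_add_distrib]
  exact Finset.sum_congr rfl fun z _ => by abel

theorem lap_smul (c : ℝ) (s : V → EuclideanSpace ℝ (Fin N)) (x : V) :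
    lap G (c • s) x = c • lap G s x := by
  simp only [lap, Pi.smul_apply, Finset.smul_sum, smul_sub]

theorem lap_apply (s : V → EuclideanSpace ℝ (Fin N)) (x : V) (l : Fin N) :
    lap G s x l = ∑ z ∈ G.neighborFinset x, (s x l - s z l) := by
  simp [lap, Finset.sum_sub_distrib]

theorem spinLaplacian_eq (σ : V → Spin N) (x : V) (l : Fin N) :
    spinLaplacian G σ x l = lap G (fun i => (σ i : EuclideanSpace ℝ (Fin N))) x l := by
  rw [lap_apply, spinLaplacian]

theorem sum_neighbors_comm (f : V → V → ℝ) :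
    ∑ x, ∑ z ∈ G.neighborFinset x, f x z = ∑ x, ∑ z ∈ G.neighborFinset x, f z x := by
  simp only [SimpleGraph.neighborFinset_eq_filter, Finset.sum_filter]
  rw [Finset.sum_comm]
  simp only [G.adj_comm]

/-- Summation by parts: exchange the two ends of each directed edge and add. -/
theorem two_mul_dirichletForm (s w : V → EuclideanSpace ℝ (Fin N)) :
    2 * dirichletForm G s w
      = ∑ x, ∑ z ∈ G.neighborFinset x, inner ℝ (w x - w z) (s x - s z) := by
  have h1 : dirichletForm G s w = ∑ x, ∑ z ∈ G.neighborFinset x, inner ℝ (w x) (s x - s z) := by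
    simp only [dirichletForm, lap, inner_sum]
  have h2 : dirichletForm G s w = ∑ x, ∑ z ∈ G.neighborFinset x, inner ℝ (w z) (s z - s x) := by
    rw [h1, sum_neighbors_comm]
  rw [two_mul]
  nth_rewrite 1 [h1]
  rw [h2, ← Finset.sum_add_distrib]
  refine Finset.sum_congr rfl fun x _ => ?_
  rw [← Finset.sum_add_distrib]
  refine Finset.sum_congr rfl fun z _ => ?_
  rw [← neg_sub (s x) (s z), inner_neg_right, inner_sub_left]
  ring

theorem two_mul_energy (s : V → EuclideanSpace ℝ (Fin N)) :
    2 * energy G s = ∑ x, ∑ z ∈ G.neighborFinset x, ‖s x - s z‖ ^ 2 :=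
  two_mul_edgeSum G _ _

theorem energy_eq_dirichletForm (s : V → EuclideanSpace ℝ (Fin N)) :
    energy G s = dirichletForm G s s := by
  have h1 := two_mul_energy G s
  have h2 := two_mul_dirichletForm G s s
  simp only [real_inner_self_eq_norm_sq] at h2
  linarith

theorem dirichletForm_comm (s w : V → EuclideanSpace ℝ (Fin N)) :
    dirichletForm G s w = dirichletForm G w s := by
  have h1 := two_mul_dirichletForm G s w
  have h2 := two_mul_dirichletForm G w s
  simp only [real_inner_comm] at h1 h2
  linarith

theorem dirichletForm_add_left (s s' w : V → EuclideanSpace ℝ (Fin N)) :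
    dirichletForm G (s + s') w = dirichletForm G s w + dirichletForm G s' w := by
  simp only [dirichletForm, lap_add, inner_add_right, Finset.sum_add_distrib]

theorem dirichletForm_smul_left (c : ℝ) (s w : V → EuclideanSpace ℝ (Fin N)) :
    dirichletForm G (c • s) w = c * dirichletForm G s w := by
  simp only [dirichletForm, lap_smul, real_inner_smul_right, Finset.mul_sum]

theorem dirichletForm_smul_right (c : ℝ) (s w : V → EuclideanSpace ℝ (Fin N)) :
    dirichletForm G s (c • w) = c * dirichletForm G s w := by
  rw [dirichletForm_comm, dirichletForm_smul_left, dirichletForm_comm]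

theorem energy_add (s w : V → EuclideanSpace ℝ (Fin N)) :
    energy G (s + w) = energy G s + 2 * dirichletForm G s w + energy G w := by
  rw [energy_eq_dirichletForm, energy_eq_dirichletForm, energy_eq_dirichletForm,
    dirichletForm_add_left, dirichletForm_comm G s (s + w), dirichletForm_comm G w (s + w),
    dirichletForm_add_left, dirichletForm_add_left, dirichletForm_comm G w s]
  ring

theorem energy_smul (c : ℝ) (w : V → EuclideanSpace ℝ (Fin N)) :
    energy G (c • w) = c ^ 2 * energy G w := by
  rw [energy_eq_dirichletForm, energy_eq_dirichletForm, dirichletForm_smul_left,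
    dirichletForm_smul_right]
  ring

theorem energy_nonneg (s : V → EuclideanSpace ℝ (Fin N)) : 0 ≤ energy G s := by
  have h := two_mul_energy G s
  have : 0 ≤ ∑ x, ∑ z ∈ G.neighborFinset x, ‖s x - s z‖ ^ 2 := by positivity
  linarith

theorem sum_neighbors_le_energy (s : V → EuclideanSpace ℝ (Fin N)) (x : V) :
    ∑ z ∈ G.neighborFinset x, ‖s x - s z‖ ^ 2 ≤ 2 * energy G s := by
  rw [two_mul_energy]
  exact Finset.single_le_sum (f := fun x => ∑ z ∈ G.neighborFinset x, ‖s x - s z‖ ^ 2)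
    (fun i _ => by positivity) (Finset.mem_univ x)

theorem norm_sub_le_sqrt_energy (s : V → EuclideanSpace ℝ (Fin N)) {x z : V} (h : G.Adj x z) :
    ‖s x - s z‖ ≤ √(2 * energy G s) := by
  refine Real.le_sqrt_of_sq_le ((Finset.single_le_sum
    (f := fun z => ‖s x - s z‖ ^ 2) (fun i _ => by positivity) ?_).trans
    (sum_neighbors_le_energy G s x))
  simpa using h

theorem norm_lap_sq_le (s : V → EuclideanSpace ℝ (Fin N)) (x : V) :
    ‖lap G s x‖ ^ 2 ≤ 2 * Fintype.card V * energy G s := by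
  have h1 : ‖lap G s x‖ ≤ ∑ z ∈ G.neighborFinset x, ‖s x - s z‖ := norm_sum_le _ _
  have h2 := sq_sum_le_card_mul_sum_sq (s := G.neighborFinset x) (f := fun z => ‖s x - s z‖)
  have h3 : ((G.neighborFinset x).card : ℝ) ≤ Fintype.card V := by
    exact_mod_cast Finset.card_le_univ _
  calc ‖lap G s x‖ ^ 2 ≤ (∑ z ∈ G.neighborFinset x, ‖s x - s z‖) ^ 2 := by gcongr
    _ ≤ _ := h2
    _ ≤ Fintype.card V * (2 * energy G s) := by
      gcongr
      exact sum_neighbors_le_energy G s x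
    _ = _ := by ring

/-- Poincaré inequality: join the vertices by a path, which has fewer than `card V` edges, each
contributing at most `√(2 * energy)`. -/
theorem exists_norm_sub_sq_le_energy (hG : G.Connected) (N : ℕ) :
    ∃ C : ℝ, 0 < C ∧ ∀ (s : V → EuclideanSpace ℝ (Fin N)) (x y : V),
      ‖s x - s y‖ ^ 2 ≤ C * energy G s := by
  have hwalk : ∀ (s : V → EuclideanSpace ℝ (Fin N)) {x y : V} (p : G.Walk x y),
      ‖s x - s y‖ ≤ p.length * √(2 * energy G s) := by
    intro s x y p
    induction p with
    | nil => simp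
    | cons h p ih =>
      rename_i u v w
      have := norm_sub_le_norm_sub_add_norm_sub (s u) (s v) (s w)
      have h1 := norm_sub_le_sqrt_energy G s h
      rw [SimpleGraph.Walk.length_cons]
      push_cast
      linarith
  refine ⟨2 * Fintype.card V ^ 2 + 1, by positivity, fun s x y => ?_⟩
  obtain ⟨p, hp⟩ := (hG.preconnected x y).exists_isPath
  have h1 := hwalk s p
  have h2 : (p.length : ℝ) ≤ Fintype.card V := by exact_mod_cast hp.length_lt.le
  have he := energy_nonneg G s
  calc ‖s x - s y‖ ^ 2 ≤ (Fintype.card V * √(2 * energy G s)) ^ 2 := by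
        gcongr
        exact h1.trans (by gcongr)
    _ = 2 * Fintype.card V ^ 2 * energy G s := by
        rw [mul_pow, Real.sq_sqrt (by positivity)]; ring
    _ ≤ _ := by gcongr; linarith

theorem dirichletForm_sub_const (s w : V → EuclideanSpace ℝ (Fin N))
    (c : EuclideanSpace ℝ (Fin N)) :
    dirichletForm G s (fun x => w x - c) = dirichletForm G s w := by
  have h1 := two_mul_dirichletForm G s w
  have h2 := two_mul_dirichletForm G s (fun x => w x - c)
  simp only [sub_sub_sub_cancel_right] at h2
  linarith

theorem energy_sub_const (w : V → EuclideanSpace ℝ (Fin N)) (c : EuclideanSpace ℝ (Fin N)) :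
    energy G (fun x => w x - c) = energy G w := by
  have h1 := two_mul_energy G w
  have h2 := two_mul_energy G (fun x => w x - c)
  simp only [sub_sub_sub_cancel_right] at h2
  linarith

/-- The energy is the sum of `(s x - s o) · lap s x`. A weighted Young inequality, with `K` tuned so
that the Poincaré inequality bounds the first squares by half the energy, allows that half to be
absorbed. -/
theorem exists_energy_le_sum_norm_lap_sq (hG : G.Connected) (N : ℕ) :
    ∃ C : ℝ, 0 < C ∧ ∀ s : V → EuclideanSpace ℝ (Fin N),
      energy G s ≤ C * ∑ x, ‖lap G s x‖ ^ 2 := by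
  obtain ⟨C, hC, h⟩ := exists_norm_sub_sq_le_energy G hG N
  obtain ⟨o⟩ := hG.nonempty
  have hV : (0 : ℝ) < Fintype.card V := by exact_mod_cast Fintype.card_pos_iff.2 ⟨o⟩
  refine ⟨C * Fintype.card V, by positivity, fun s => ?_⟩
  set K : ℝ := C * Fintype.card V with hK
  have hKpos : 0 < K := by positivity
  have h1 : energy G s = ∑ x, inner ℝ (s x - s o) (lap G s x) := by
    rw [energy_eq_dirichletForm, ← dirichletForm_sub_const G s s (s o)]
    rfl
  have h2 : ∀ x, inner ℝ (s x - s o) (lap G s x)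
      ≤ ‖s x - s o‖ ^ 2 / (2 * K) + K / 2 * ‖lap G s x‖ ^ 2 := by
    intro x
    refine (real_inner_le_norm _ _).trans ?_
    have h3 : ‖s x - s o‖ ^ 2 / (2 * K) + K / 2 * ‖lap G s x‖ ^ 2 - ‖s x - s o‖ * ‖lap G s x‖
      = (‖s x - s o‖ - K * ‖lap G s x‖) ^ 2 / (2 * K) := by
      field_simp
      ring
    have h4 : 0 ≤ (‖s x - s o‖ - K * ‖lap G s x‖) ^ 2 / (2 * K) := by positivity
    linarith
  have h3 : ∑ x, ‖s x - s o‖ ^ 2 / (2 * K) ≤ energy G s / 2 := by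
    calc ∑ x, ‖s x - s o‖ ^ 2 / (2 * K) ≤ ∑ _x : V, C * energy G s / (2 * K) := by
          gcongr with x
          exact h s x o
      _ = energy G s / 2 := by
          rw [Finset.sum_const, Finset.card_univ, nsmul_eq_mul, hK]
          field_simp
  have h4 := Finset.sum_le_sum fun x (_ : x ∈ Finset.univ) => h2 x
  rw [← h1, Finset.sum_add_distrib, ← Finset.mul_sum] at h4
  linarith

theorem energy_pos (hG : G.Connected) {v : V → EuclideanSpace ℝ (Fin N)}
    (hv : ∃ x y, v x ≠ v y) : 0 < energy G v := by
  obtain ⟨C, hC, h⟩ := exists_norm_sub_sq_le_energy G hG N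
  obtain ⟨x, y, hxy⟩ := hv
  have h1 : 0 < ‖v x - v y‖ ^ 2 := by
    have := norm_pos_iff.2 (sub_ne_zero.2 hxy)
    positivity
  exact pos_of_mul_pos_right (h1.trans_le (h v x y)) hC.le

theorem lap_eq_sum_lapMatrix (s : V → EuclideanSpace ℝ (Fin N)) (x : V) :
    lap G s x = ∑ y, G.lapMatrix ℝ x y • s y := by
  ext l
  have h := SimpleGraph.lapMatrix_mulVec_apply (G := G) (R := ℝ) x (fun z => s z l)
  rw [lap_apply, Finset.sum_sub_distrib, Finset.sum_const, nsmul_eq_mul,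
    SimpleGraph.card_neighborFinset_eq_degree, ← h]
  simp [Matrix.mulVec, dotProduct]

/-- The source of the matrix entry in the limit: it is the response of the Laplacian at `y` to a
move of the spin at `x` alone. -/
theorem lap_single (x y : V) (u : EuclideanSpace ℝ (Fin N)) :
    lap G (Pi.single x u) y = G.lapMatrix ℝ x y • u := by
  rw [lap_eq_sum_lapMatrix, Finset.sum_eq_single x (fun z _ hz => by simp [hz]) (by simp),
    Pi.single_eq_same, (G.isSymm_lapMatrix (R := ℝ)).apply]

theorem energy_eq_sum_lapMatrix (v : V → EuclideanSpace ℝ (Fin N)) :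
    energy G v = ∑ l, ∑ x, ∑ y, v x l * v y l * G.lapMatrix ℝ x y := by
  rw [energy_eq_dirichletForm, dirichletForm, Finset.sum_comm]
  refine Finset.sum_congr rfl fun x _ => ?_
  rw [lap_eq_sum_lapMatrix, inner_sum, Finset.sum_comm]
  refine Finset.sum_congr rfl fun y _ => ?_
  rw [real_inner_smul_right, PiLp.inner_apply, Finset.mul_sum]
  refine Finset.sum_congr rfl fun l _ => ?_
  simp only [RCLike.inner_apply, conj_trivial]
  ring

end GraphForms

/-! ### Integration by parts and the Schwinger–Dyson equation. -/

section Configurations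

variable {V : Type*} [Fintype V] [DecidableEq V] (G : SimpleGraph V) [DecidableRel G.Adj] {N : ℕ}

instance : IsFiniteMeasure (configMeasure V N) := by
  unfold configMeasure
  infer_instance

/-- A spin configuration as a vector field on the vertices. -/
def toField (σ : V → Spin N) : V → EuclideanSpace ℝ (Fin N) := fun i => σ i

theorem toField_apply (σ : V → Spin N) (x : V) : toField σ x = σ x := rfl

theorem norm_toField (σ : V → Spin N) (x : V) : ‖toField σ x‖ = 1 :=
  mem_sphere_zero_iff_norm.1 (σ x).2

theorem continuous_toField : Continuous (toField : (V → Spin N) → _) := by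
  unfold toField
  fun_prop

theorem contDiff_lap_apply {n : WithTop ℕ∞} (x : V) (l : Fin N) :
    ContDiff ℝ n fun s : V → EuclideanSpace ℝ (Fin N) => lap G s x l := by
  simp only [lap_apply]
  fun_prop

theorem contDiff_lap {n : WithTop ℕ∞} (x : V) :
    ContDiff ℝ n fun s : V → EuclideanSpace ℝ (Fin N) => lap G s x := by
  unfold lap
  fun_prop

theorem contDiff_energy {n : WithTop ℕ∞} :
    ContDiff ℝ n fun s : V → EuclideanSpace ℝ (Fin N) => energy G s := by
  simp only [energy_eq_dirichletForm, dirichletForm]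
  exact ContDiff.sum fun x _ => ContDiff.inner ℝ (contDiff_apply ℝ _ x) (contDiff_lap G x)

/-- The Boltzmann weight `exp (-(β / 2) ∑ ‖s_i - s_j‖ ^ 2)` of a vector field. -/
def weight (β : ℝ) (s : V → EuclideanSpace ℝ (Fin N)) : ℝ := Real.exp (-(β / 2) * energy G s)

theorem contDiff_weight {n : WithTop ℕ∞} (β : ℝ) :
    ContDiff ℝ n fun s : V → EuclideanSpace ℝ (Fin N) => weight G β s := by
  unfold weight
  have := contDiff_energy G (N := N) (n := n)
  fun_prop

theorem weight_pos (β : ℝ) (s : V → EuclideanSpace ℝ (Fin N)) : 0 < weight G β s :=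
  Real.exp_pos _

/-- The infinitesimal rotation of the plane of the coordinates `a` and `b`. -/
def planarGenerator (a b : Fin N) (v : EuclideanSpace ℝ (Fin N)) : EuclideanSpace ℝ (Fin N) :=
  v a • EuclideanSpace.single b (1 : ℝ) - v b • EuclideanSpace.single a (1 : ℝ)

/-- Integration by parts: the product measure is invariant under the infinitesimal rotations of a
single spin. -/
theorem integral_fderiv_planarGenerator {a b : Fin N} (hab : a ≠ b) (x : V)
    {Φ : (V → EuclideanSpace ℝ (Fin N)) → ℝ} (hΦ : ContDiff ℝ 1 Φ) :
    ∫ σ, fderiv ℝ Φ (toField σ) (Pi.single x (planarGenerator a b (toField σ x)))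
      ∂(configMeasure V N) = 0 := by
  let S : EuclideanSpace ℝ (Fin N) →L[ℝ] (V → EuclideanSpace ℝ (Fin N)) :=
    ContinuousLinearMap.single ℝ (fun _ => EuclideanSpace ℝ (Fin N)) x
  -- `c t v` is the displacement of `v` under the planar rotation by `t`, and `c'` its derivative in
  -- `t`, equal to the planar generator at `t = 0`.
  let c : ℝ → EuclideanSpace ℝ (Fin N) → EuclideanSpace ℝ (Fin N) := fun t v =>
    ((Real.cos t - 1) * v a - Real.sin t * v b) • EuclideanSpace.single a (1 : ℝ)
      + (Real.sin t * v a + (Real.cos t - 1) * v b) • EuclideanSpace.single b (1 : ℝ)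
  let c' : ℝ → EuclideanSpace ℝ (Fin N) → EuclideanSpace ℝ (Fin N) := fun t v =>
    (-Real.sin t * v a - Real.cos t * v b) • EuclideanSpace.single a (1 : ℝ)
      + (Real.cos t * v a + -Real.sin t * v b) • EuclideanSpace.single b (1 : ℝ)
  have hc : ∀ t v, HasDerivAt (fun s => c s v) (c' t v) t := by
    intro t v
    have h1 := (Real.hasDerivAt_cos t).sub_const 1
    have h2 := Real.hasDerivAt_sin t
    exact (((h1.mul_const (v a)).sub (h2.mul_const (v b))).smul_const _).add
      (((h2.mul_const (v a)).add (h1.mul_const (v b))).smul_const _)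
  have htf := continuous_toField (V := V) (N := N)
  have hev : Continuous fun p : ℝ × (V → Spin N) => toField p.2 x := by
    exact (continuous_apply x).comp (htf.comp continuous_snd)
  have hcc : Continuous fun p : ℝ × (V → Spin N) => c p.1 (toField p.2 x) := by
    simp only [c]
    fun_prop
  have hcc' : Continuous fun p : ℝ × (V → Spin N) => c' p.1 (toField p.2 x) := by
    simp only [c']
    fun_prop
  have hγ : Continuous fun p : ℝ × (V → Spin N) => toField p.2 + S (c p.1 (toField p.2 x)) :=
    (htf.comp continuous_snd).add (S.continuous.comp hcc)
  have hd := hasDerivAt_integral_of_continuous (configMeasure V N)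
    (F := fun t σ => Φ (toField σ + S (c t (toField σ x))))
    (F' := fun t σ => fderiv ℝ Φ (toField σ + S (c t (toField σ x))) (S (c' t (toField σ x))))
    (hΦ.continuous.comp hγ)
    (((hΦ.continuous_fderiv one_ne_zero).comp hγ).clm_apply (S.continuous.comp hcc'))
    (fun t σ => by
      have h1 : HasDerivAt (fun s => toField σ + S (c s (toField σ x)))
          (S (c' t (toField σ x))) t :=
        (S.hasFDerivAt.comp_hasDerivAt t (hc t (toField σ x))).const_add _
      exact ((hΦ.differentiable one_ne_zero).differentiableAt.hasFDerivAt).comp_hasDerivAt t h1) 0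
  -- The shifted field is the configuration with only the spin at `x` rotated, so invariance makes
  -- the integral independent of `t`.
  have hconst : (fun t => ∫ σ, Φ (toField σ + S (c t (toField σ x))) ∂(configMeasure V N))
      = fun _ => ∫ σ, Φ (toField σ) ∂(configMeasure V N) := by
    funext t
    have hrot := integral_rotateConfig (Function.update (fun _ => LinearIsometryEquiv.refl ℝ _) x
      (planarRotation hab t)) (hΦ.continuous.comp htf)
    simp only [Function.comp] at hrot
    rw [← hrot]
    congr 1
    funext σ
    congr 1
    funext y
    by_cases hy : y = x
    · subst hy
      simp [toField, rotateSpin, S, c, planarRotation_apply, planarMap, add_assoc]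
    · simp [toField, rotateSpin, S, hy]
  rw [hconst] at hd
  have := hd.unique (hasDerivAt_const 0 _)
  rw [← this]
  congr 1
  funext σ
  simp [S, c, c', planarGenerator]
  congr 2
  abel

theorem hasDerivAt_weight_line (β : ℝ) (s w : V → EuclideanSpace ℝ (Fin N)) (t : ℝ) :
    HasDerivAt (fun t : ℝ => weight G β (s + t • w))
      (-β * (dirichletForm G s w + t * energy G w) * weight G β (s + t • w)) t := by
  have h1 : HasDerivAt (fun t : ℝ => energy G (s + t • w))
      (2 * (dirichletForm G s w + t * energy G w)) t := by
    simp only [energy_add, dirichletForm_smul_right, energy_smul]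
    have h := (((hasDerivAt_id t).mul_const (dirichletForm G s w)).const_mul 2).const_add
      (energy G s) |>.add (((hasDerivAt_id t).pow 2).mul_const (energy G w))
    refine h.congr_deriv ?_
    simp
    ring
  refine ((h1.const_mul (-(β / 2))).exp).congr_deriv ?_
  unfold weight
  ring

/-- The test function is the `(a, b)` component of `σ_x ∧ Δσ_y` times the weight. Rotating `σ_x`
infinitesimally, the factor `Δσ_y` yields the matrix entry, the factor `σ_x` yields the radial
terms, and the weight yields `-β` times the same component of `σ_x ∧ Δσ_x`. -/
theorem integral_planar_identity {a b : Fin N} (hab : a ≠ b) (β : ℝ) (x y : V) :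
    ∫ σ, (G.lapMatrix ℝ x y * (toField σ x a ^ 2 + toField σ x b ^ 2)
        - toField σ x a * lap G (toField σ) y a - toField σ x b * lap G (toField σ) y b
        - β * ((toField σ x a * lap G (toField σ) x b - toField σ x b * lap G (toField σ) x a)
          * (toField σ x a * lap G (toField σ) y b - toField σ x b * lap G (toField σ) y a)))
        * weight G β (toField σ) ∂(configMeasure V N) = 0 := by
  have hl := contDiff_lap_apply G (N := N) (n := 1) y
  have hw := contDiff_weight G (N := N) (n := 1) β
  have hΦ : ContDiff ℝ 1 fun s : V → EuclideanSpace ℝ (Fin N) =>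
      (s x a * lap G s y b - s x b * lap G s y a) * weight G β s := by
    fun_prop
  rw [← integral_fderiv_planarGenerator hab x hΦ]
  congr 1
  funext σ
  generalize toField σ = s
  set w : V → EuclideanSpace ℝ (Fin N) := Pi.single x (planarGenerator a b (s x)) with hwdef
  have h1 : HasLineDerivAt ℝ (fun s : V → EuclideanSpace ℝ (Fin N) =>
      (s x a * lap G s y b - s x b * lap G s y a) * weight G β s) _ s w :=
    ((hΦ.differentiable one_ne_zero).differentiableAt.hasFDerivAt).hasLineDerivAt w
  have ha : planarGenerator a b (s x) a = -s x b := by simp [planarGenerator, hab]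
  have hb : planarGenerator a b (s x) b = s x a := by simp [planarGenerator, hab.symm]
  have h2 : HasDerivAt (fun t : ℝ =>
      ((s x a - t * s x b) * (lap G s y b + t * (G.lapMatrix ℝ x y * s x a))
        - (s x b + t * s x a) * (lap G s y a - t * (G.lapMatrix ℝ x y * s x b)))
      * weight G β (s + t • w)) _ 0 :=
    (((((hasDerivAt_id (0 : ℝ)).mul_const (s x b)).const_sub (s x a)).mul
      (((hasDerivAt_id (0 : ℝ)).mul_const (G.lapMatrix ℝ x y * s x a)).const_add
        (lap G s y b))).sub
    ((((hasDerivAt_id (0 : ℝ)).mul_const (s x a)).const_add (s x b)).mul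
      (((hasDerivAt_id (0 : ℝ)).mul_const (G.lapMatrix ℝ x y * s x b)).const_sub
        (lap G s y a)))).mul (hasDerivAt_weight_line G β s w 0)
  have h3 : (fun t : ℝ => ((s + t • w) x a * lap G (s + t • w) y b
      - (s + t • w) x b * lap G (s + t • w) y a) * weight G β (s + t • w)) = fun t : ℝ =>
      ((s x a - t * s x b) * (lap G s y b + t * (G.lapMatrix ℝ x y * s x a))
        - (s x b + t * s x a) * (lap G s y a - t * (G.lapMatrix ℝ x y * s x b)))
      * weight G β (s + t • w) := by
    funext t
    rw [lap_add, lap_smul, hwdef, lap_single]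
    simp only [Pi.add_apply, Pi.smul_apply, Pi.single_eq_same, PiLp.add_apply, PiLp.smul_apply,
      smul_eq_mul, ha, hb]
    ring
  unfold HasLineDerivAt at h1
  rw [h3] at h1
  have h4 := h1.unique h2
  rw [h4]
  have h5 : dirichletForm G s w = s x a * lap G s x b - s x b * lap G s x a := by
    rw [dirichletForm, Finset.sum_eq_single x (fun z _ hz => by simp [hwdef, hz]) (by simp), hwdef,
      Pi.single_eq_same, planarGenerator, inner_sub_left, real_inner_smul_left,
      real_inner_smul_left, EuclideanSpace.inner_single_left, EuclideanSpace.inner_single_left]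
    simp
  simp [h5]
  ring

/-- Lagrange's identity for a unit vector. The diagonal `a = b` corresponds to no rotation and is
removed, which turns `N` into `N - 1`. -/
theorem sum_planar_terms (s D D' : EuclideanSpace ℝ (Fin N)) (hs : ‖s‖ = 1) (L β : ℝ) :
    ∑ a, ∑ b, (L * (s a ^ 2 + s b ^ 2) - s a * D' a - s b * D' b
        - β * ((s a * D b - s b * D a) * (s a * D' b - s b * D' a)))
      - ∑ a, (L * (s a ^ 2 + s a ^ 2) - s a * D' a - s a * D' a)
    = 2 * (((N : ℝ) - 1) * (L - inner ℝ s D')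
        - β * (inner ℝ D D' - inner ℝ s D * inner ℝ s D')) := by
  have hS : ∑ a, s a ^ 2 = 1 := by
    rw [← EuclideanSpace.real_norm_sq_eq, hs, one_pow]
  have hin : ∀ u v : EuclideanSpace ℝ (Fin N), inner ℝ u v = ∑ a, u a * v a := by
    intro u v
    simp [PiLp.inner_apply, mul_comm]
  have e1 : ∀ a b : Fin N, (L * (s a ^ 2 + s b ^ 2) - s a * D' a - s b * D' b
        - β * ((s a * D b - s b * D a) * (s a * D' b - s b * D' a)))
      = (L * s a ^ 2 - s a * D' a) + (L * s b ^ 2 - s b * D' b)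
        - β * (s a ^ 2 * (D b * D' b) + (D a * D' a) * s b ^ 2
          - (s a * D' a) * (s b * D b) - (s a * D a) * (s b * D' b)) := by
    intro a b
    ring
  simp only [e1, Finset.sum_sub_distrib, Finset.sum_add_distrib, ← Finset.mul_sum,
    ← Finset.sum_mul, Finset.sum_const, Finset.card_univ, Fintype.card_fin, nsmul_eq_mul, hS, hin]
  have hL : ∑ a, (N : ℝ) * (s a * D' a) = N * ∑ a, s a * D' a := (Finset.mul_sum _ _ _).symm
  simp only [mul_left_comm _ (N : ℝ), hL]
  ring

/-- The Schwinger–Dyson equation obtained by summing the integrations by parts over all coordinate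
planes. -/
theorem integral_schwinger_dyson (β : ℝ) (x y : V) :
    ∫ σ, (((N : ℝ) - 1) * (G.lapMatrix ℝ x y - inner ℝ (toField σ x) (lap G (toField σ) y))
        - β * (inner ℝ (lap G (toField σ) x) (lap G (toField σ) y)
          - inner ℝ (toField σ x) (lap G (toField σ) x)
            * inner ℝ (toField σ x) (lap G (toField σ) y)))
        * weight G β (toField σ) ∂(configMeasure V N) = 0 := by
  obtain ⟨J, hJdef⟩ : ∃ J : Fin N → Fin N → (V → EuclideanSpace ℝ (Fin N)) → ℝ,
      ∀ a b s, J a b s = G.lapMatrix ℝ x y * (s x a ^ 2 + s x b ^ 2) - s x a * lap G s y a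
        - s x b * lap G s y b - β * ((s x a * lap G s x b - s x b * lap G s x a)
        * (s x a * lap G s y b - s x b * lap G s y a)) := ⟨_, fun _ _ _ => rfl⟩
  have hJ : ∀ a b, Continuous (J a b) := by
    intro a b
    have hs : ∀ l, Continuous fun s : V → EuclideanSpace ℝ (Fin N) => s x l := fun l => by fun_prop
    have hD := fun z l => (contDiff_lap_apply G (N := N) (n := 0) z l).continuous
    rw [show J a b = _ from funext (hJdef a b)]
    exact (((continuous_const.mul (((hs a).pow 2).add ((hs b).pow 2))).sub
      ((hs a).mul (hD y a))).sub ((hs b).mul (hD y b))).sub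
      (continuous_const.mul ((((hs a).mul (hD x b)).sub ((hs b).mul (hD x a))).mul
        (((hs a).mul (hD y b)).sub ((hs b).mul (hD y a)))))
  have hw := (contDiff_weight G (N := N) (n := 0) β).continuous
  have htf := continuous_toField (V := V) (N := N)
  have h0 : ∀ a b, ∫ σ, (J a b (toField σ) - if a = b then J a a (toField σ) else 0)
      * weight G β (toField σ) ∂(configMeasure V N) = 0 := by
    intro a b
    by_cases hab : a = b
    · subst hab; simp
    · simp only [hab, if_false, sub_zero]
      simp only [hJdef]
      exact integral_planar_identity G hab β x y
  have hc : ∀ a b, Continuous fun σ : V → Spin N =>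
      (J a b (toField σ) - if a = b then J a a (toField σ) else 0)
      * weight G β (toField σ) := by
    intro a b
    have h1 := hJ a b
    by_cases hab : a = b
    · simp only [hab, if_true, sub_self, zero_mul]
      exact continuous_const
    · simp only [hab, if_false, sub_zero]
      exact (h1.comp htf).mul (hw.comp htf)
  have hsum : ∫ σ, ∑ a, ∑ b, (J a b (toField σ) - if a = b then J a a (toField σ) else 0)
      * weight G β (toField σ) ∂(configMeasure V N) = 0 := by
    rw [integral_finsetSum _ fun a _ => integrable_of_continuous _
      (continuous_finsetSum _ fun b _ => hc a b)]
    refine Finset.sum_eq_zero fun a _ => ?_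
    rw [integral_finsetSum _ fun b _ => integrable_of_continuous _ (hc a b)]
    exact Finset.sum_eq_zero fun b _ => h0 a b
  have hpt : ∀ σ : V → Spin N,
      ∑ a, ∑ b, (J a b (toField σ) - if a = b then J a a (toField σ) else 0)
        * weight G β (toField σ)
      = 2 * ((((N : ℝ) - 1) * (G.lapMatrix ℝ x y - inner ℝ (toField σ x) (lap G (toField σ) y))
        - β * (inner ℝ (lap G (toField σ) x) (lap G (toField σ) y)
          - inner ℝ (toField σ x) (lap G (toField σ) x)
            * inner ℝ (toField σ x) (lap G (toField σ) y))) * weight G β (toField σ)) := by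
    intro σ
    rw [← mul_assoc, ← sum_planar_terms _ _ _ (norm_toField σ x)]
    simp only [← Finset.sum_mul, Finset.sum_sub_distrib, Finset.sum_ite_eq, Finset.mem_univ,
      if_true, hJdef]
    simp
  simp only [hpt, integral_const_mul] at hsum
  simpa using hsum

end Configurations

/-! ### Low-temperature concentration and the limit of the trace. -/

section Gibbs

variable {V : Type*} [Fintype V] [DecidableEq V] (G : SimpleGraph V) [DecidableRel G.Adj] {N : ℕ}

theorem continuous_energy_toField : Continuous fun σ : V → Spin N => energy G (toField σ) :=
  (contDiff_energy G (n := 0)).continuous.comp continuous_toField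

theorem continuous_weight_toField (β : ℝ) :
    Continuous fun σ : V → Spin N => weight G β (toField σ) :=
  (contDiff_weight G (n := 0) β).continuous.comp continuous_toField

theorem continuous_lap_toField (x : V) : Continuous fun σ : V → Spin N => lap G (toField σ) x :=
  (contDiff_lap G (n := 0) x).continuous.comp continuous_toField

theorem continuous_inner_lap_toField (x y : V) :
    Continuous fun σ : V → Spin N => inner ℝ (toField σ x) (lap G (toField σ) y) :=
  ((continuous_apply x).comp continuous_toField).inner (continuous_lap_toField G y)

theorem modifiedPartition_zero (β : ℝ) :
    modifiedPartition G N β 0 = ∫ σ, weight G β (toField σ) ∂(configMeasure V N) := by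
  simp only [modifiedPartition, weight, Pi.zero_apply, add_zero]
  rfl

/-- For unit vectors `‖σ_i - σ_j‖ ^ 2 = 2 - 2 σ_i · σ_j`; the constant cancels in the normalized
measure. -/
theorem exists_hamiltonian_eq (N : ℕ) :
    ∃ c : ℝ, ∀ σ : V → Spin N, hamiltonian G σ = energy G (toField σ) / 2 - c := by
  refine ⟨(∑ x, ∑ z ∈ G.neighborFinset x, (1 : ℝ)) / 2, fun σ => ?_⟩
  have h1 := two_mul_edgeSum G
    (fun i j => inner ℝ (σ i : EuclideanSpace ℝ (Fin N)) (σ j)) (fun _ _ => real_inner_comm _ _)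
  have h2 := two_mul_energy G (toField σ)
  have h3 : ∀ x z, ‖toField σ x - toField σ z‖ ^ 2
      = 2 * 1 - 2 * inner ℝ (σ x : EuclideanSpace ℝ (Fin N)) (σ z) := by
    intro x z
    rw [norm_sub_sq_real, norm_toField, norm_toField, toField_apply, toField_apply]
    ring
  simp only [h3, Finset.sum_sub_distrib, ← Finset.mul_sum] at h2
  rw [hamiltonian]
  linarith

theorem integral_gibbsMeasure (β : ℝ) (f : (V → Spin N) → ℝ) :
    ∫ σ, f σ ∂(gibbsMeasure G N β)
      = (∫ σ, f σ * weight G β (toField σ) ∂(configMeasure V N)) / modifiedPartition G N β 0 := by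
  obtain ⟨c, hc⟩ := exists_hamiltonian_eq G N
  have h1 : ∀ σ : V → Spin N,
      Real.exp (-β * hamiltonian G σ) = Real.exp (β * c) * weight G β (toField σ) := by
    intro σ
    rw [weight, ← Real.exp_add, hc]
    congr 1
    ring
  rw [gibbsMeasure, integral_tilted, modifiedPartition_zero]
  simp only [h1, integral_const_mul, smul_eq_mul]
  rw [← integral_div]
  refine integral_congr_ae (Eventually.of_forall fun σ => ?_)
  have := Real.exp_ne_zero (β * c)
  simp only
  rw [mul_div_mul_left _ _ this]
  ring

instance : (configMeasure V N).IsOpenPosMeasure := by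
  have h : (surfaceMeasure N).IsOpenPosMeasure := by
    unfold surfaceMeasure
    infer_instance
  exact Measure.pi.isOpenPosMeasure (fun _ : V => surfaceMeasure N)

instance (β : ℝ) : IsFiniteMeasure (gibbsMeasure (V := V) G N β) := by
  unfold gibbsMeasure
  infer_instance

/-- The ferromagnetic configurations have small energy, so that the partition function is not
smaller than any exponential. -/
theorem exists_le_modifiedPartition_zero (hN : 1 ≤ N) {ε : ℝ} (hε : 0 < ε) :
    ∃ m : ℝ, 0 < m ∧ ∀ β : ℝ, 0 ≤ β → m * Real.exp (-(β / 2) * ε) ≤ modifiedPartition G N β 0 := by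
  let A : Set (V → Spin N) := {σ | energy G (toField σ) < ε}
  have hA : IsOpen A := isOpen_lt (continuous_energy_toField G) continuous_const
  have hne : A.Nonempty := by
    refine ⟨fun _ => ⟨EuclideanSpace.single ⟨0, hN⟩ 1, by simp⟩, ?_⟩
    have := two_mul_energy G (toField (fun _ : V => (⟨EuclideanSpace.single ⟨0, hN⟩ 1, by simp⟩ :
      Spin N)))
    simp only [toField_apply, sub_self, norm_zero] at this
    simp only [A, Set.mem_ofPred_eq]
    simp at this
    linarith
  refine ⟨(configMeasure V N).real A, ?_, fun β hβ => ?_⟩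
  · exact ENNReal.toReal_pos (hA.measure_ne_zero _ hne) (measure_ne_top _ _)
  · rw [modifiedPartition_zero]
    have hint := integrable_of_continuous (configMeasure V N)
      (continuous_weight_toField G (N := N) β)
    calc (configMeasure V N).real A * Real.exp (-(β / 2) * ε)
        = ∫ _ in A, Real.exp (-(β / 2) * ε) ∂(configMeasure V N) := by simp
      _ ≤ ∫ σ in A, weight G β (toField σ) ∂(configMeasure V N) := by
          refine setIntegral_mono_on (integrable_const _).integrableOn hint.integrableOn
            hA.measurableSet fun σ hσ => ?_
          refine Real.exp_le_exp.2 ?_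
          have : energy G (toField σ) < ε := hσ
          nlinarith
      _ ≤ ∫ σ, weight G β (toField σ) ∂(configMeasure V N) :=
          setIntegral_le_integral hint (Eventually.of_forall fun σ => (weight_pos G β _).le)

theorem configMeasure_ne_zero (hN : 1 ≤ N) : NeZero (configMeasure V N) := by
  have : Nonempty (V → Spin N) := ⟨fun _ => ⟨EuclideanSpace.single ⟨0, hN⟩ 1, by simp⟩⟩
  infer_instance

theorem modifiedPartition_zero_pos (hN : 1 ≤ N) (β : ℝ) : 0 < modifiedPartition G N β 0 := by
  have := configMeasure_ne_zero (V := V) hN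
  rw [modifiedPartition_zero]
  exact integral_exp_pos (integrable_of_continuous (configMeasure V N)
    (continuous_weight_toField G (N := N) β))

theorem isProbabilityMeasure_gibbsMeasure (hN : 1 ≤ N) (β : ℝ) :
    IsProbabilityMeasure (gibbsMeasure (V := V) G N β) := by
  have := configMeasure_ne_zero (V := V) hN
  obtain ⟨c, hc⟩ := exists_hamiltonian_eq G N
  refine isProbabilityMeasure_tilted (integrable_of_continuous _ ?_)
  simp only [hc]
  have := continuous_energy_toField G (N := N)
  fun_prop

/-- Concentration of the Gibbs measures: large energies are exponentially unlikely. -/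
theorem exists_integral_energy_sq_le (hN : 1 ≤ N) {ε : ℝ} (hε : 0 < ε) :
    ∃ C : ℝ, ∀ β : ℝ, 0 ≤ β →
      ∫ σ, energy G (toField σ) ^ 2 ∂(gibbsMeasure G N β)
        ≤ ε * ∫ σ, energy G (toField σ) ∂(gibbsMeasure G N β) + C * Real.exp (-(ε / 4) * β) := by
  -- Using `ε / 2` here leaves room: the weight above energy `ε` is at most `exp (-βε/2)`, against a
  -- partition function of at least `m exp (-βε/4)`.
  obtain ⟨m, hm, hmZ⟩ := exists_le_modifiedPartition_zero G hN (half_pos hε)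
  obtain ⟨R, hR⟩ := (isCompact_univ (X := V → Spin N)).exists_bound_of_continuousOn
    (continuous_energy_toField G (N := N)).continuousOn
  set M := (configMeasure V N).real Set.univ with hM
  refine ⟨R ^ 2 * M / m, fun β hβ => ?_⟩
  have hce := continuous_energy_toField G (N := N)
  have hcw := continuous_weight_toField G (N := N) β
  have hZ := modifiedPartition_zero_pos G hN β
  rw [integral_gibbsMeasure, integral_gibbsMeasure]
  have h1 : ∫ σ, (energy G (toField σ) ^ 2 * weight G β (toField σ)
      - ε * (energy G (toField σ) * weight G β (toField σ))) ∂(configMeasure V N)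
      ≤ ∫ _, R ^ 2 * Real.exp (-(β / 2) * ε) ∂(configMeasure V N) := by
    refine integral_mono (integrable_of_continuous _ (by fun_prop)) (integrable_const _)
      fun σ => ?_
    have hr0 := energy_nonneg G (toField σ)
    have hrR : energy G (toField σ) ≤ R := (le_abs_self _).trans (hR σ (Set.mem_univ _))
    have hw := weight_pos G β (toField σ)
    have hexp := Real.exp_pos (-(β / 2) * ε)
    simp only
    rcases le_or_gt (energy G (toField σ)) ε with h | h
    · have : energy G (toField σ) ^ 2 * weight G β (toField σ)
          - ε * (energy G (toField σ) * weight G β (toField σ)) ≤ 0 := by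
        have : 0 ≤ energy G (toField σ) * weight G β (toField σ) * (ε - energy G (toField σ)) :=
          mul_nonneg (by positivity) (by linarith)
        linarith
      exact this.trans (by positivity)
    · have hwle : weight G β (toField σ) ≤ Real.exp (-(β / 2) * ε) :=
        Real.exp_le_exp.2 (by nlinarith)
      calc _ ≤ energy G (toField σ) ^ 2 * weight G β (toField σ) := by
            have : 0 ≤ ε * (energy G (toField σ) * weight G β (toField σ)) := by positivity
            linarith
        _ ≤ _ := by gcongr
  rw [integral_sub (integrable_of_continuous _ (by fun_prop))
    (integrable_of_continuous _ (by fun_prop)), integral_const_mul, integral_const, smul_eq_mul,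
    ← hM] at h1
  have h2 := hmZ β hβ
  have h3 : Real.exp (-(β / 2) * ε) = Real.exp (-(β / 2) * (ε / 2)) * Real.exp (-(ε / 4) * β) := by
    rw [← Real.exp_add]
    congr 1
    ring
  have hMnn : 0 ≤ M := measureReal_nonneg
  have h4 : M * (R ^ 2 * Real.exp (-(β / 2) * ε))
      ≤ R ^ 2 * M / m * Real.exp (-(ε / 4) * β) * modifiedPartition G N β 0 := by
    calc M * (R ^ 2 * Real.exp (-(β / 2) * ε))
        = R ^ 2 * M / m * Real.exp (-(ε / 4) * β) * (m * Real.exp (-(β / 2) * (ε / 2))) := by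
          rw [h3]; field_simp
      _ ≤ _ := by gcongr
  rw [← mul_div_assoc, div_add' _ _ _ hZ.ne']
  gcongr
  linarith

/-- On the sphere the radial part of the Laplacian is of second order in the differences; this makes
the last Schwinger–Dyson term negligible. -/
theorem inner_self_lap_eq (σ : V → Spin N) (x : V) :
    inner ℝ (toField σ x) (lap G (toField σ) x)
      = (∑ z ∈ G.neighborFinset x, ‖toField σ x - toField σ z‖ ^ 2) / 2 := by
  rw [lap, inner_sum, Finset.sum_div]
  refine Finset.sum_congr rfl fun z _ => ?_
  rw [norm_sub_sq_real, norm_toField, norm_toField, inner_sub_right, real_inner_self_eq_norm_sq,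
    norm_toField]
  ring

theorem inner_self_lap_nonneg (σ : V → Spin N) (x : V) :
    0 ≤ inner ℝ (toField σ x) (lap G (toField σ) x) := by
  rw [inner_self_lap_eq]
  positivity

theorem inner_self_lap_le_energy (σ : V → Spin N) (x : V) :
    inner ℝ (toField σ x) (lap G (toField σ) x) ≤ energy G (toField σ) := by
  rw [inner_self_lap_eq]
  have := sum_neighbors_le_energy G (toField σ) x
  linarith

theorem integral_inner_lap_lap (hN : 1 ≤ N) (β : ℝ) (x y : V) :
    β * ∫ σ, inner ℝ (lap G (toField σ) x) (lap G (toField σ) y) ∂(gibbsMeasure G N β)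
      = ((N : ℝ) - 1) * (G.lapMatrix ℝ x y
          - ∫ σ, inner ℝ (toField σ x) (lap G (toField σ) y) ∂(gibbsMeasure G N β))
        + β * ∫ σ, inner ℝ (toField σ x) (lap G (toField σ) x)
            * inner ℝ (toField σ x) (lap G (toField σ) y) ∂(gibbsMeasure G N β) := by
  have := isProbabilityMeasure_gibbsMeasure (V := V) G hN β
  have h := integral_schwinger_dyson (N := N) G β x y
  have h1 : ∫ σ, (((N : ℝ) - 1) * (G.lapMatrix ℝ x y
      - inner ℝ (toField σ x) (lap G (toField σ) y))
      - β * (inner ℝ (lap G (toField σ) x) (lap G (toField σ) y)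
        - inner ℝ (toField σ x) (lap G (toField σ) x)
          * inner ℝ (toField σ x) (lap G (toField σ) y))) ∂(gibbsMeasure G N β) = 0 := by
    rw [integral_gibbsMeasure, h, zero_div]
  have hc1 := continuous_inner_lap_toField G (N := N) x y
  have hc2 := continuous_inner_lap_toField G (N := N) x x
  have hc3 := (continuous_lap_toField G (N := N) x).inner (𝕜 := ℝ) (continuous_lap_toField G y)
  have i1 := integrable_of_continuous (gibbsMeasure G N β) hc1
  have i2 : Integrable (fun σ : V → Spin N => inner ℝ (toField σ x) (lap G (toField σ) x)
      * inner ℝ (toField σ x) (lap G (toField σ) y)) (gibbsMeasure G N β) :=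
    integrable_of_continuous (gibbsMeasure G N β) (hc2.mul hc1)
  generalize hL : G.lapMatrix ℝ x y = L at h1 ⊢
  have i4 : Integrable (fun σ : V → Spin N => ((N : ℝ) - 1)
      * (L - inner ℝ (toField σ x) (lap G (toField σ) y)))
      (gibbsMeasure G N β) := ((integrable_const _).sub i1).const_mul _
  have i5 : Integrable (fun σ : V → Spin N =>
      β * (inner ℝ (lap G (toField σ) x) (lap G (toField σ) y)
        - inner ℝ (toField σ x) (lap G (toField σ) x)
          * inner ℝ (toField σ x) (lap G (toField σ) y)))
      (gibbsMeasure G N β) := ((integrable_of_continuous _ hc3).sub i2).const_mul _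
  have i3 := integrable_of_continuous (gibbsMeasure G N β) hc3
  rw [integral_sub i4 i5, integral_const_mul, integral_const_mul,
    integral_sub (integrable_const _) i1,
    integral_sub i3 i2, integral_const] at h1
  simp only [probReal_univ, one_smul] at h1
  linarith

theorem tendsto_mul_exp_neg_mul {c : ℝ} (hc : 0 < c) :
    Tendsto (fun β : ℝ => β * Real.exp (-c * β)) atTop (𝓝 0) := by
  simpa using tendsto_rpow_mul_exp_neg_mul_atTop_nhds_zero 1 c hc

/-- The energy is of the order of the temperature. -/
theorem exists_eventually_integral_energy_le (hG : G.Connected) (hN : 1 ≤ N) :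
    ∃ K : ℝ, 0 < K ∧ ∀ᶠ β in atTop,
      β * ∫ σ, energy G (toField σ) ∂(gibbsMeasure G N β) ≤ K := by
  obtain ⟨C, hC, hCe⟩ := exists_energy_le_sum_norm_lap_sq G hG N
  have hN1 : (0 : ℝ) ≤ (N : ℝ) - 1 := by
    have : (1 : ℝ) ≤ N := by exact_mod_cast hN
    linarith
  obtain ⟨o⟩ := hG.nonempty
  have hV : (0 : ℝ) < Fintype.card V := by exact_mod_cast Fintype.card_pos_iff.2 ⟨o⟩
  set C₁ : ℝ := C * Fintype.card V with hC₁
  have hC₁pos : 0 < C₁ := by positivity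
  set C₀ : ℝ := C * ∑ x, ((N : ℝ) - 1) * G.lapMatrix ℝ x x with hC₀
  -- With this `ε` the term `C₁ * (β * I₂)` costs half of `β * I₁` plus an exponentially small
  -- remainder.
  obtain ⟨C₂, hC₂⟩ := exists_integral_energy_sq_le G hN (ε := 1 / (2 * C₁)) (by positivity)
  have hlim := (tendsto_mul_exp_neg_mul (c := 1 / (2 * C₁) / 4) (by positivity)).const_mul
    (2 * C₁ * C₂)
  rw [mul_zero] at hlim
  -- The factor 2 comes from absorbing half of `β * I₁`; the 1 bounds the remainder for large `β`.
  refine ⟨2 * |C₀| + 1, by positivity, ?_⟩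
  filter_upwards [hlim.eventually (gt_mem_nhds one_pos), eventually_ge_atTop 0] with β hβ1 hβ0
  have := isProbabilityMeasure_gibbsMeasure (V := V) G hN β
  have hce := continuous_energy_toField G (N := N)
  set I₁ := ∫ σ, energy G (toField σ) ∂(gibbsMeasure G N β)
  set I₂ := ∫ σ, energy G (toField σ) ^ 2 ∂(gibbsMeasure G N β)
  -- For `x = y` the term linear in the radial part has a favourable sign and is dropped; its square
  -- is at most the squared energy.
  have hsite : ∀ x, β * ∫ σ, ‖lap G (toField σ) x‖ ^ 2 ∂(gibbsMeasure G N β)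
      ≤ ((N : ℝ) - 1) * G.lapMatrix ℝ x x + β * I₂ := by
    intro x
    have h := integral_inner_lap_lap G hN β x x
    simp only [real_inner_self_eq_norm_sq] at h
    have hc := continuous_inner_lap_toField G (N := N) x x
    have h1 : 0 ≤ ∫ σ, inner ℝ (toField σ x) (lap G (toField σ) x) ∂(gibbsMeasure G N β) :=
      integral_nonneg fun σ => inner_self_lap_nonneg G σ x
    have h2 : ∫ σ, inner ℝ (toField σ x) (lap G (toField σ) x)
        * inner ℝ (toField σ x) (lap G (toField σ) x) ∂(gibbsMeasure G N β) ≤ I₂ := by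
      refine integral_mono (integrable_of_continuous _ (hc.mul hc))
        (integrable_of_continuous _ (hce.pow 2)) fun σ => ?_
      have h3 := inner_self_lap_nonneg G σ x
      have h4 := inner_self_lap_le_energy G σ x
      simp only
      nlinarith
    rw [h]
    have h5 := mul_le_mul_of_nonneg_left h2 hβ0
    have h6 := mul_nonneg hN1 h1
    linarith
  have hsum : I₁ ≤ C * ∑ x, ∫ σ, ‖lap G (toField σ) x‖ ^ 2 ∂(gibbsMeasure G N β) := by
    have hcl : ∀ x, Continuous fun σ : V → Spin N => ‖lap G (toField σ) x‖ ^ 2 :=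
      fun x => (continuous_lap_toField G (N := N) x).norm.pow 2
    rw [← integral_finsetSum _ fun x _ => integrable_of_continuous _ (hcl x),
      ← integral_const_mul]
    exact integral_mono (integrable_of_continuous _ hce) (integrable_of_continuous _
      (continuous_const.mul (continuous_finsetSum _ fun x _ => hcl x))) fun σ => hCe _
  have h1 : β * I₁ ≤ C₀ + C₁ * (β * I₂) := by
    calc β * I₁ ≤ β * (C * ∑ x, ∫ σ, ‖lap G (toField σ) x‖ ^ 2 ∂(gibbsMeasure G N β)) := by gcongr
      _ = C * ∑ x, β * ∫ σ, ‖lap G (toField σ) x‖ ^ 2 ∂(gibbsMeasure G N β) := by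
          rw [← Finset.mul_sum]; ring
      _ ≤ C * ∑ x, (((N : ℝ) - 1) * G.lapMatrix ℝ x x + β * I₂) := by
          gcongr with x
          exact hsite x
      _ = C₀ + C₁ * (β * I₂) := by
          rw [Finset.sum_add_distrib, Finset.sum_const, Finset.card_univ, nsmul_eq_mul]
          ring
  have h2 := mul_le_mul_of_nonneg_left (mul_le_mul_of_nonneg_left (hC₂ β hβ0) hβ0) hC₁pos.le
  have h3 : C₁ * (β * (1 / (2 * C₁) * I₁ + C₂ * Real.exp (-(1 / (2 * C₁) / 4) * β)))
      = β * I₁ / 2 + 2 * C₁ * C₂ * (β * Real.exp (-(1 / (2 * C₁) / 4) * β)) / 2 := by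
    field_simp
  rw [h3] at h2
  have h4 := le_abs_self C₀
  linarith

theorem tendsto_integral_energy (hG : G.Connected) (hN : 1 ≤ N) :
    Tendsto (fun β : ℝ => ∫ σ, energy G (toField σ) ∂(gibbsMeasure G N β)) atTop (𝓝 0) := by
  obtain ⟨K, hK, hKe⟩ := exists_eventually_integral_energy_le G hG hN
  refine squeeze_zero' (Eventually.of_forall fun β => integral_nonneg fun σ => energy_nonneg G _)
    ?_ (tendsto_const_nhds.div_atTop tendsto_id : Tendsto (fun β : ℝ => K / β) atTop (𝓝 0))
  filter_upwards [hKe, eventually_gt_atTop 0] with β h1 h2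
  rwa [le_div_iff₀ h2, mul_comm]

/-- The concentration bound holds for every `ε`, and `β` times the mean energy stays bounded. -/
theorem tendsto_mul_integral_energy_sq (hG : G.Connected) (hN : 1 ≤ N) :
    Tendsto (fun β : ℝ => β * ∫ σ, energy G (toField σ) ^ 2 ∂(gibbsMeasure G N β))
      atTop (𝓝 0) := by
  obtain ⟨K, hK, hKe⟩ := exists_eventually_integral_energy_le G hG hN
  refine tendsto_order.2 ⟨fun a ha => ?_, fun a ha => ?_⟩
  · filter_upwards [eventually_ge_atTop 0] with β hβ
    exact ha.trans_le (mul_nonneg hβ (integral_nonneg fun σ => sq_nonneg _))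
  · obtain ⟨C, hC⟩ := exists_integral_energy_sq_le G hN (ε := a / (2 * K)) (by positivity)
    have hlim := (tendsto_mul_exp_neg_mul (c := a / (2 * K) / 4) (by positivity)).const_mul C
    rw [mul_zero] at hlim
    filter_upwards [hlim.eventually (gt_mem_nhds (half_pos ha)), hKe, eventually_ge_atTop 0]
      with β h1 h2 h3
    have h4 := mul_le_mul_of_nonneg_left (hC β h3) h3
    have h5 := mul_le_mul_of_nonneg_left h2 (show 0 ≤ a / (2 * K) by positivity)
    have h6 : a / (2 * K) * K = a / 2 := by field_simp
    linarith

/-- The parameter `η` of a Young inequality is fixed before `β → ∞`; this takes the place of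
Cauchy–Schwarz for the expectations. -/
theorem tendsto_zero_of_abs_le {f g : ℝ → ℝ} {A B : ℝ} (hA : 0 < A)
    (hg : Tendsto g atTop (𝓝 0))
    (h : ∀ η : ℝ, 0 < η → ∀ᶠ β in atTop, |f β| ≤ η * A + B / η * g β) :
    Tendsto f atTop (𝓝 0) := by
  rw [tendsto_zero_iff_abs_tendsto_zero f]
  refine tendsto_order.2 ⟨fun a ha => Eventually.of_forall fun β => ha.trans_le (abs_nonneg _),
    fun a ha => ?_⟩
  have h1 := hg.const_mul (B / (a / (2 * A)))
  rw [mul_zero] at h1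
  filter_upwards [h1.eventually (gt_mem_nhds (half_pos ha)), h (a / (2 * A)) (by positivity)]
    with β h2 h3
  have h4 : a / (2 * A) * A = a / 2 := by field_simp
  simp only [Function.comp]
  linarith

/-- For `x ≠ y` there is no second-order cancellation, only a bound by the square root of the
energy, linearized here by Young's inequality. -/
theorem abs_inner_lap_le (σ : V → Spin N) (x y : V) {η : ℝ} (hη : 0 < η) :
    |inner ℝ (toField σ x) (lap G (toField σ) y)|
      ≤ η + 2 * Fintype.card V / η * energy G (toField σ) := by
  have h1 := abs_real_inner_le_norm (toField σ x) (lap G (toField σ) y)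
  rw [norm_toField, one_mul] at h1
  have h2 := norm_lap_sq_le G (toField σ) y
  have h3 : ‖lap G (toField σ) y‖ ≤ η + ‖lap G (toField σ) y‖ ^ 2 / η := by
    rw [← sub_nonneg]
    have : η + ‖lap G (toField σ) y‖ ^ 2 / η - ‖lap G (toField σ) y‖
        = ((η - ‖lap G (toField σ) y‖) ^ 2 + η * ‖lap G (toField σ) y‖) / η := by
      field_simp
      ring
    rw [this]
    positivity
  calc _ ≤ _ := h1
    _ ≤ _ := h3
    _ ≤ η + 2 * Fintype.card V * energy G (toField σ) / η := by gcongr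
    _ = _ := by ring

theorem tendsto_integral_inner_lap (hG : G.Connected) (hN : 1 ≤ N) (x y : V) :
    Tendsto (fun β : ℝ => ∫ σ, inner ℝ (toField σ x) (lap G (toField σ) y) ∂(gibbsMeasure G N β))
      atTop (𝓝 0) := by
  refine tendsto_zero_of_abs_le one_pos (tendsto_integral_energy G hG hN)
    (B := 2 * Fintype.card V) fun η hη => Eventually.of_forall fun β => ?_
  have := isProbabilityMeasure_gibbsMeasure (V := V) G hN β
  have i1 := integrable_of_continuous (gibbsMeasure G N β) (continuous_energy_toField G)
  calc _ ≤ ∫ σ, |inner ℝ (toField σ x) (lap G (toField σ) y)| ∂(gibbsMeasure G N β) :=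
        abs_integral_le_integral_abs
    _ ≤ ∫ σ, (η + 2 * Fintype.card V / η * energy G (toField σ)) ∂(gibbsMeasure G N β) :=
        integral_mono (integrable_of_continuous _ (continuous_inner_lap_toField G x y).abs)
          ((integrable_const _).add (i1.const_mul _)) fun σ => abs_inner_lap_le G σ x y hη
    _ = _ := by
        rw [integral_add (integrable_const _) (i1.const_mul _), integral_const,
          integral_const_mul]
        simp

theorem tendsto_mul_integral_inner_mul_inner (hG : G.Connected) (hN : 1 ≤ N) (x y : V) :
    Tendsto (fun β : ℝ => β * ∫ σ, inner ℝ (toField σ x) (lap G (toField σ) x)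
      * inner ℝ (toField σ x) (lap G (toField σ) y) ∂(gibbsMeasure G N β)) atTop (𝓝 0) := by
  obtain ⟨K, hK, hKe⟩ := exists_eventually_integral_energy_le G hG hN
  refine tendsto_zero_of_abs_le hK (tendsto_mul_integral_energy_sq G hG hN)
    (B := 2 * Fintype.card V) fun η hη => ?_
  filter_upwards [hKe, eventually_ge_atTop 0] with β hβK hβ
  have := isProbabilityMeasure_gibbsMeasure (V := V) G hN β
  have hce := continuous_energy_toField G (N := N)
  have i1 := integrable_of_continuous (gibbsMeasure G N β) hce
  have i2 : Integrable (fun σ : V → Spin N => energy G (toField σ) ^ 2) (gibbsMeasure G N β) :=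
    integrable_of_continuous _ (hce.pow 2)
  have h1 : |∫ σ, inner ℝ (toField σ x) (lap G (toField σ) x)
      * inner ℝ (toField σ x) (lap G (toField σ) y) ∂(gibbsMeasure G N β)|
      ≤ η * ∫ σ, energy G (toField σ) ∂(gibbsMeasure G N β)
        + 2 * Fintype.card V / η * ∫ σ, energy G (toField σ) ^ 2 ∂(gibbsMeasure G N β) := by
    rw [← integral_const_mul, ← integral_const_mul, ← integral_add (i1.const_mul _)
      (i2.const_mul _)]
    refine abs_integral_le_integral_abs.trans (integral_mono (integrable_of_continuous _
      ((continuous_inner_lap_toField G x x).mul (continuous_inner_lap_toField G x y)).abs)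
      ((i1.const_mul _).add (i2.const_mul _)) fun σ => ?_)
    have h2 := inner_self_lap_nonneg G σ x
    have h3 := inner_self_lap_le_energy G σ x
    have h4 := abs_inner_lap_le G σ x y hη
    simp only
    rw [abs_mul, abs_of_nonneg h2]
    calc _ ≤ energy G (toField σ) * (η + 2 * Fintype.card V / η * energy G (toField σ)) :=
          mul_le_mul h3 h4 (abs_nonneg _) (energy_nonneg G _)
      _ = _ := by ring
  rw [abs_mul, abs_of_nonneg hβ]
  have h5 := mul_le_mul_of_nonneg_left h1 hβ
  have h6 := mul_le_mul_of_nonneg_left hβK hη.le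
  linarith

theorem tendsto_mul_integral_inner_lap_lap (hG : G.Connected) (hN : 1 ≤ N) (x y : V) :
    Tendsto (fun β : ℝ => β * ∫ σ, inner ℝ (lap G (toField σ) x) (lap G (toField σ) y)
      ∂(gibbsMeasure G N β)) atTop (𝓝 (((N : ℝ) - 1) * G.lapMatrix ℝ x y)) := by
  simp only [integral_inner_lap_lap G hN]
  simpa using ((tendsto_const_nhds (x := G.lapMatrix ℝ x y)).sub
    (tendsto_integral_inner_lap G hG hN x y)).const_mul ((N : ℝ) - 1) |>.add
    (tendsto_mul_integral_inner_mul_inner G hG hN x y)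

end Gibbs

/-! ### Global symmetries, and the covariances of single components. -/

section Symmetries

variable {V : Type*} [Fintype V] [DecidableEq V] (G : SimpleGraph V) [DecidableRel G.Adj] {N : ℕ}

theorem energy_comp_isometry
    (R : EuclideanSpace ℝ (Fin N) ≃ₗᵢ[ℝ] EuclideanSpace ℝ (Fin N))
    (s : V → EuclideanSpace ℝ (Fin N)) : energy G (fun x => R (s x)) = energy G s := by
  have h1 := two_mul_energy G s
  have h2 := two_mul_energy G (fun x => R (s x))
  simp only [← map_sub, LinearIsometryEquiv.norm_map] at h2
  linarith

theorem lap_comp_isometry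
    (R : EuclideanSpace ℝ (Fin N) ≃ₗᵢ[ℝ] EuclideanSpace ℝ (Fin N))
    (s : V → EuclideanSpace ℝ (Fin N)) (x : V) : lap G (fun x => R (s x)) x = R (lap G s x) := by
  simp only [lap, map_sum, map_sub]

/-- The Gibbs measures are invariant under global rotations of the spins. -/
theorem integral_gibbsMeasure_rotate
    (R : EuclideanSpace ℝ (Fin N) ≃ₗᵢ[ℝ] EuclideanSpace ℝ (Fin N)) (β : ℝ)
    {f : (V → EuclideanSpace ℝ (Fin N)) → ℝ} (hf : Continuous f) :
    ∫ σ, f (fun x => R (toField σ x)) ∂(gibbsMeasure G N β)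
      = ∫ σ, f (toField σ) ∂(gibbsMeasure G N β) := by
  rw [integral_gibbsMeasure, integral_gibbsMeasure]
  congr 1
  have hc : Continuous fun σ : V → Spin N => f (toField σ) * weight G β (toField σ) :=
    (hf.comp continuous_toField).mul (continuous_weight_toField G β)
  rw [← integral_rotateConfig (fun _ : V => R) hc]
  refine integral_congr_ae (Eventually.of_forall fun σ => ?_)
  have h1 : toField (fun x => rotateSpin R (σ x)) = fun x => R (toField σ x) := rfl
  simp only [h1, weight, energy_comp_isometry]

theorem continuous_lap_apply_mul (x y : V) (k l : Fin N) :
    Continuous fun s : V → EuclideanSpace ℝ (Fin N) => lap G s x k * lap G s y l :=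
  (contDiff_lap_apply G (n := 0) x k).continuous.mul (contDiff_lap_apply G (n := 0) y l).continuous

/-- Reflecting the coordinate `k` of all spins changes the sign of the integrand. -/
theorem integral_lap_mul_lap_of_ne (β : ℝ) (x y : V) {k l : Fin N} (hkl : k ≠ l) :
    ∫ σ, lap G (toField σ) x k * lap G (toField σ) y l ∂(gibbsMeasure G N β) = 0 := by
  let R : EuclideanSpace ℝ (Fin N) ≃ₗᵢ[ℝ] EuclideanSpace ℝ (Fin N) :=
    LinearIsometryEquiv.piLpCongrRight 2
      (fun i => if i = k then LinearIsometryEquiv.neg ℝ else LinearIsometryEquiv.refl ℝ ℝ)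
  have h := integral_gibbsMeasure_rotate G R β (continuous_lap_apply_mul G x y k l)
  have hk : ∀ v, R v k = -v k := fun v => by simp [R]
  have hl : ∀ v, R v l = v l := fun v => by simp [R, hkl.symm]
  simp only [lap_comp_isometry, hk, hl, neg_mul, integral_neg] at h
  linarith

theorem integral_lap_mul_lap_eq (β : ℝ) (x y : V) (k l : Fin N) :
    ∫ σ, lap G (toField σ) x k * lap G (toField σ) y k ∂(gibbsMeasure G N β)
      = ∫ σ, lap G (toField σ) x l * lap G (toField σ) y l ∂(gibbsMeasure G N β) := by
  let R : EuclideanSpace ℝ (Fin N) ≃ₗᵢ[ℝ] EuclideanSpace ℝ (Fin N) :=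
    LinearIsometryEquiv.piLpCongrLeft 2 ℝ ℝ (Equiv.swap k l)
  have h := integral_gibbsMeasure_rotate G R β (continuous_lap_apply_mul G x y l l)
  have hl : ∀ v, R v l = v k := fun v => by
    simp [R, LinearIsometryEquiv.piLpCongrLeft_apply, Equiv.piCongrLeft']
  simp only [lap_comp_isometry, hl] at h
  exact h

theorem integrable_lap_mul_lap (β : ℝ) (x y : V) (k l : Fin N) :
    Integrable (fun σ => lap G (toField σ) x k * lap G (toField σ) y l) (gibbsMeasure G N β) :=
  integrable_of_continuous _ ((continuous_lap_apply_mul G x y k l).comp continuous_toField)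

/-- By coordinate swaps all `N` components contribute equally to the trace. -/
theorem tendsto_mul_integral_lap_mul_lap (hG : G.Connected) (hN : 1 ≤ N) (l : Fin N) (x y : V) :
    Tendsto (fun β : ℝ => β * ∫ σ, lap G (toField σ) x l * lap G (toField σ) y l
      ∂(gibbsMeasure G N β)) atTop (𝓝 (((N : ℝ) - 1) / N * G.lapMatrix ℝ x y)) := by
  have hN0 : (N : ℝ) ≠ 0 := by positivity
  have h1 : ∀ β : ℝ, ∫ σ, inner ℝ (lap G (toField σ) x) (lap G (toField σ) y)
      ∂(gibbsMeasure G N β)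
      = N * ∫ σ, lap G (toField σ) x l * lap G (toField σ) y l ∂(gibbsMeasure G N β) := by
    intro β
    have h2 : ∀ u v : EuclideanSpace ℝ (Fin N), inner ℝ u v = ∑ k, u k * v k := by
      intro u v
      simp [PiLp.inner_apply, mul_comm]
    simp only [h2]
    rw [integral_finsetSum _ fun k _ => integrable_lap_mul_lap G β x y k k,
      Finset.sum_congr rfl fun k _ => integral_lap_mul_lap_eq G β x y k l]
    simp
  have h2 := (tendsto_mul_integral_inner_lap_lap G hG hN x y).const_mul (1 / (N : ℝ))
  convert h2 using 2
  · rw [h1]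
    field_simp
  · field_simp

theorem dirichletForm_eq_sum (s v : V → EuclideanSpace ℝ (Fin N)) :
    dirichletForm G s v = ∑ l, ∑ x, v x l * lap G s x l := by
  rw [dirichletForm, Finset.sum_comm]
  refine Finset.sum_congr rfl fun x _ => ?_
  simp [PiLp.inner_apply, mul_comm]

theorem continuous_dirichletForm_toField (v : V → EuclideanSpace ℝ (Fin N)) :
    Continuous fun σ : V → Spin N => dirichletForm G (toField σ) v :=
  continuous_finsetSum _ fun x _ => continuous_const.inner (continuous_lap_toField G x)

theorem integral_dirichletForm_sq (β : ℝ) (v : V → EuclideanSpace ℝ (Fin N)) :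
    ∫ σ, dirichletForm G (toField σ) v ^ 2 ∂(gibbsMeasure G N β)
      = ∑ l, ∑ x, ∑ y, v x l * v y l
        * ∫ σ, lap G (toField σ) x l * lap G (toField σ) y l ∂(gibbsMeasure G N β) := by
  have h1 : ∀ σ : V → Spin N, dirichletForm G (toField σ) v ^ 2
      = ∑ l, ∑ k, ∑ x, ∑ y, v x l * v y k * (lap G (toField σ) x l * lap G (toField σ) y k) := by
    intro σ
    rw [dirichletForm_eq_sum, sq, Finset.sum_mul_sum]
    refine Finset.sum_congr rfl fun l _ => Finset.sum_congr rfl fun k _ => ?_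
    rw [Finset.sum_mul_sum]
    refine Finset.sum_congr rfl fun x _ => Finset.sum_congr rfl fun y _ => ?_
    ring
  have i1 := fun l k x y => (integrable_lap_mul_lap G (N := N) β x y l k).const_mul (v x l * v y k)
  simp only [h1]
  rw [integral_finsetSum _ fun l _ => integrable_finsetSum _ fun k _ =>
    integrable_finsetSum _ fun x _ => integrable_finsetSum _ fun y _ => i1 l k x y]
  refine Finset.sum_congr rfl fun l _ => ?_
  rw [integral_finsetSum _ fun k _ =>
    integrable_finsetSum _ fun x _ => integrable_finsetSum _ fun y _ => i1 l k x y]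
  have h2 : ∀ k, ∫ σ, ∑ x, ∑ y, v x l * v y k * (lap G (toField σ) x l * lap G (toField σ) y k)
      ∂(gibbsMeasure G N β) = ∑ x, ∑ y, v x l * v y k
        * ∫ σ, lap G (toField σ) x l * lap G (toField σ) y k ∂(gibbsMeasure G N β) := by
    intro k
    rw [integral_finsetSum _ fun x _ => integrable_finsetSum _ fun y _ => i1 l k x y]
    refine Finset.sum_congr rfl fun x _ => ?_
    rw [integral_finsetSum _ fun y _ => i1 l k x y]
    exact Finset.sum_congr rfl fun y _ => integral_const_mul _ _
  simp only [h2]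
  refine Finset.sum_eq_single l (fun k _ hk => ?_) (by simp)
  refine Finset.sum_eq_zero fun x _ => Finset.sum_eq_zero fun y _ => ?_
  rw [integral_lap_mul_lap_of_ne G β x y hk.symm, mul_zero]

/-- The rescaled covariances of the Laplacian of the spins converge, as quadratic forms, uniformly
on bounded sets. -/
theorem exists_tendsto_abs_integral_dirichletForm_sq_sub_le (hG : G.Connected) (hN : 1 ≤ N) :
    ∃ T : ℝ → ℝ, Tendsto T atTop (𝓝 0) ∧
      ∀ (β M : ℝ) (v : V → EuclideanSpace ℝ (Fin N)), (∀ x, ‖v x‖ ^ 2 ≤ M) →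
        |β * ∫ σ, dirichletForm G (toField σ) v ^ 2 ∂(gibbsMeasure G N β)
          - ((N : ℝ) - 1) / N * energy G v| ≤ T β * M := by
  refine ⟨fun β => ∑ l : Fin N, ∑ x, ∑ y, |β * ∫ σ, lap G (toField σ) x l * lap G (toField σ) y l
    ∂(gibbsMeasure G N β) - ((N : ℝ) - 1) / N * G.lapMatrix ℝ x y|, ?_, fun β M v hv => ?_⟩
  · have h0 : (0 : ℝ) = ∑ _l : Fin N, ∑ _x : V, ∑ _y : V, |(0 : ℝ)| := by simp
    rw [h0]
    refine tendsto_finsetSum _ fun l _ => tendsto_finsetSum _ fun x _ =>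
      tendsto_finsetSum _ fun y _ => Tendsto.abs ?_
    simpa using (tendsto_mul_integral_lap_mul_lap G hG hN l x y).sub_const
      (((N : ℝ) - 1) / N * G.lapMatrix ℝ x y)
  · rw [integral_dirichletForm_sq, energy_eq_sum_lapMatrix]
    simp only [Finset.mul_sum, Finset.sum_mul, ← Finset.sum_sub_distrib]
    have hcoord : ∀ x l, v x l ^ 2 ≤ M := by
      intro x l
      have h := PiLp.norm_apply_le (v x) l
      rw [Real.norm_eq_abs] at h
      calc v x l ^ 2 = |v x l| ^ 2 := (sq_abs _).symm
        _ ≤ ‖v x‖ ^ 2 := by gcongr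
        _ ≤ M := hv x
    refine (Finset.abs_sum_le_sum_abs _ _).trans (Finset.sum_le_sum fun l _ => ?_)
    refine (Finset.abs_sum_le_sum_abs _ _).trans (Finset.sum_le_sum fun x _ => ?_)
    refine (Finset.abs_sum_le_sum_abs _ _).trans (Finset.sum_le_sum fun y _ => ?_)
    have h1 : |v x l * v y l| ≤ M := by
      have h2 := hcoord x l
      have h3 := hcoord y l
      rw [abs_le]
      constructor <;> nlinarith [sq_nonneg (v x l + v y l), sq_nonneg (v x l - v y l)]
    rw [mul_comm _ M]
    calc _ = |v x l * v y l| * |β * ∫ σ, lap G (toField σ) x l * lap G (toField σ) y l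
          ∂(gibbsMeasure G N β) - ((N : ℝ) - 1) / N * G.lapMatrix ℝ x y| := by
          rw [← abs_mul]
          congr 1
          ring
      _ ≤ _ := by gcongr

end Symmetries

/-! ### The modified partition function: smoothness, second derivative, domination. -/

section ModifiedPartition

variable {V : Type*} [Fintype V] [DecidableEq V] (G : SimpleGraph V) [DecidableRel G.Adj] {N : ℕ}

theorem modifiedPartition_eq (β : ℝ) (h : V → EuclideanSpace ℝ (Fin N)) :
    modifiedPartition G N β h = ∫ σ, weight G β (toField σ + h) ∂(configMeasure V N) := rfl

/-- The exponent is a quadratic polynomial in the shift with values in the continuous functions of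
`σ`. -/
theorem contDiff_modifiedPartition {n : WithTop ℕ∞} (β : ℝ) :
    ContDiff ℝ n (modifiedPartition G N β) := by
  let E₀ : C(V → Spin N, ℝ) := ⟨_, continuous_energy_toField G⟩
  let D : Fin N → V → C(V → Spin N, ℝ) := fun l x =>
    ⟨_, (contDiff_lap_apply G (n := 0) x l).continuous.comp continuous_toField⟩
  let Q : (V → EuclideanSpace ℝ (Fin N)) → C(V → Spin N, ℝ) := fun h =>
    (-(β / 2)) • (E₀ + (2 : ℝ) • ∑ l, ∑ x, h x l • D l x + energy G h • (1 : C(V → Spin N, ℝ)))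
  have hQ : ContDiff ℝ n Q := by
    have h1 := contDiff_energy G (N := N) (n := n)
    have h2 : ∀ l x, ContDiff ℝ n fun h : V → EuclideanSpace ℝ (Fin N) => h x l • D l x :=
      fun l x => by
        have h3 : ContDiff ℝ n fun h : V → EuclideanSpace ℝ (Fin N) => h x l := by fun_prop
        exact h3.smul contDiff_const
    have h3 : ContDiff ℝ n fun h : V → EuclideanSpace ℝ (Fin N) => ∑ l, ∑ x, h x l • D l x :=
      ContDiff.sum fun l _ => ContDiff.sum fun x _ => h2 l x
    have h4 : ContDiff ℝ n fun h : V → EuclideanSpace ℝ (Fin N) =>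
        energy G h • (1 : C(V → Spin N, ℝ)) := h1.smul contDiff_const
    exact ContDiff.const_smul _ (((contDiff_const (c := E₀)).add
      (ContDiff.const_smul (2 : ℝ) h3)).add h4)
  convert contDiff_integral_exp (configMeasure V N) hQ using 2 with h
  rw [modifiedPartition_eq]
  refine integral_congr_ae (Eventually.of_forall fun σ => ?_)
  simp [weight, energy_add, dirichletForm_eq_sum, Q, E₀, D]
  ring

theorem secondDeriv_eq (hN : 1 ≤ N) (β : ℝ) (v : V → EuclideanSpace ℝ (Fin N)) :
    secondDeriv G N β v = β * modifiedPartition G N β 0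
      * (β * ∫ σ, dirichletForm G (toField σ) v ^ 2 ∂(gibbsMeasure G N β) - energy G v) := by
  have hline : Continuous fun p : ℝ × (V → Spin N) => weight G β (toField p.2 + p.1 • v) :=
    (contDiff_weight G (n := 0) β).continuous.comp
      ((continuous_toField.comp continuous_snd).add (continuous_fst.smul continuous_const))
  have hB : Continuous fun p : ℝ × (V → Spin N) => dirichletForm G (toField p.2) v :=
    (continuous_dirichletForm_toField G v).comp continuous_snd
  let F : ℝ → (V → Spin N) → ℝ := fun t σ => weight G β (toField σ + t • v)
  let F' : ℝ → (V → Spin N) → ℝ := fun t σ =>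
    -β * (dirichletForm G (toField σ) v + t * energy G v) * weight G β (toField σ + t • v)
  let F'' : ℝ → (V → Spin N) → ℝ := fun t σ =>
    (β ^ 2 * (dirichletForm G (toField σ) v + t * energy G v) ^ 2 - β * energy G v)
      * weight G β (toField σ + t • v)
  have hF : Continuous (Function.uncurry F) := hline
  have hF' : Continuous (Function.uncurry F') := by
    have : Continuous fun p : ℝ × (V → Spin N) =>
        -β * (dirichletForm G (toField p.2) v + p.1 * energy G v)
        * weight G β (toField p.2 + p.1 • v) :=
      (continuous_const.mul (hB.add (continuous_fst.mul continuous_const))).mul hline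
    exact this
  have hF'' : Continuous (Function.uncurry F'') := by
    have : Continuous fun p : ℝ × (V → Spin N) =>
        (β ^ 2 * (dirichletForm G (toField p.2) v + p.1 * energy G v) ^ 2 - β * energy G v)
        * weight G β (toField p.2 + p.1 • v) :=
      ((continuous_const.mul ((hB.add (continuous_fst.mul continuous_const)).pow 2)).sub
        continuous_const).mul hline
    exact this
  have hd1 : ∀ t σ, HasDerivAt (fun s => F s σ) (F' t σ) t := fun t σ =>
    hasDerivAt_weight_line G β (toField σ) v t
  have hd2 : ∀ t σ, HasDerivAt (fun s => F' s σ) (F'' t σ) t := by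
    intro t σ
    refine (((((hasDerivAt_id t).mul_const (energy G v)).const_add
      (dirichletForm G (toField σ) v)).const_mul (-β)).mul
      (hasDerivAt_weight_line G β (toField σ) v t)).congr_deriv ?_
    simp only [F'', id]
    ring
  have h1 := hasDerivAt_integral_of_continuous (configMeasure V N) hF hF' hd1
  have h2 := hasDerivAt_integral_of_continuous (configMeasure V N) hF' hF'' hd2 0
  have h3 : secondDeriv G N β v = ∫ σ, F'' 0 σ ∂(configMeasure V N) := by
    rw [secondDeriv, iteratedDeriv_succ, iteratedDeriv_one]
    have : deriv (fun η : ℝ => modifiedPartition G N β (η • v))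
        = fun t => ∫ σ, F' t σ ∂(configMeasure V N) := funext fun t => (h1 t).deriv
    rw [this, h2.deriv]
  have hZ := modifiedPartition_zero_pos G hN β
  have hc := continuous_dirichletForm_toField G v
  have hw := continuous_weight_toField G (N := N) β
  rw [h3, integral_gibbsMeasure]
  simp only [F'', zero_mul, add_zero, zero_smul, sub_mul, mul_assoc]
  have i1 : Integrable (fun σ : V → Spin N => β ^ 2 * (dirichletForm G (toField σ) v ^ 2
      * weight G β (toField σ))) (configMeasure V N) :=
    integrable_of_continuous _ (continuous_const.mul ((hc.pow 2).mul hw))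
  have i2 : Integrable (fun σ : V → Spin N => β * (energy G v * weight G β (toField σ)))
      (configMeasure V N) :=
    integrable_of_continuous _ (continuous_const.mul (continuous_const.mul hw))
  rw [integral_sub i1 i2,
    integral_const_mul, integral_const_mul, integral_const_mul, ← modifiedPartition_zero]
  field_simp

/-- Cauchy–Schwarz, from the discriminant of `t ↦ energy (s + t • w)`. -/
theorem dirichletForm_sq_le (s w : V → EuclideanSpace ℝ (Fin N)) :
    dirichletForm G s w ^ 2 ≤ energy G s * energy G w := by
  have h : ∀ t : ℝ, 0 ≤ energy G w * (t * t) + 2 * dirichletForm G s w * t + energy G s := by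
    intro t
    have h1 := energy_nonneg G (s + t • w)
    rw [energy_add, dirichletForm_smul_right, energy_smul] at h1
    linarith
  have := discrim_le_zero h
  rw [discrim] at this
  linarith

/-- Expanding the energy of `σ + h` leaves an exponential linear in `σ`; the symmetry `σ ↦ -σ`
symmetrizes it. -/
theorem modifiedPartition_eq_integral_cosh (hN : 1 ≤ N) (β : ℝ)
    (h : V → EuclideanSpace ℝ (Fin N)) :
    modifiedPartition G N β h = modifiedPartition G N β 0 * Real.exp (-(β / 2 * energy G h))
      * ∫ σ, Real.cosh (β * dirichletForm G (toField σ) h) ∂(gibbsMeasure G N β) := by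
  have hc := continuous_dirichletForm_toField G h
  have i1 : ∀ c : ℝ, Integrable (fun σ : V → Spin N =>
      Real.exp (c * dirichletForm G (toField σ) h)) (gibbsMeasure G N β) := fun c =>
    integrable_of_continuous _ (Real.continuous_exp.comp (continuous_const.mul hc))
  have hcF : Continuous fun s : V → EuclideanSpace ℝ (Fin N) =>
      Real.exp (β * dirichletForm G s h) := by
    refine Real.continuous_exp.comp (continuous_const.mul ?_)
    exact continuous_finsetSum _ fun x _ => continuous_const.inner
      (contDiff_lap G (n := 0) x).continuous
  have hsymm := integral_gibbsMeasure_rotate G (LinearIsometryEquiv.neg ℝ) β hcF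
  have hneg : ∀ s : V → EuclideanSpace ℝ (Fin N), dirichletForm G
      (fun x => (LinearIsometryEquiv.neg ℝ : EuclideanSpace ℝ (Fin N) ≃ₗᵢ[ℝ] _) (s x)) h
      = -dirichletForm G s h := by
    intro s
    simp only [dirichletForm, lap_comp_isometry]
    simp
  simp only [hneg, mul_neg] at hsymm
  have hcosh : ∫ σ, Real.cosh (β * dirichletForm G (toField σ) h) ∂(gibbsMeasure G N β)
      = ∫ σ, Real.exp (-(β * dirichletForm G (toField σ) h)) ∂(gibbsMeasure G N β) := by
    simp only [Real.cosh_eq]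
    have i2 := i1 β
    have i3 := i1 (-β)
    simp only [neg_mul] at i3
    rw [integral_div, integral_add i2 i3, ← hsymm]
    ring
  have hZ := modifiedPartition_zero_pos G (V := V) hN β
  rw [hcosh, integral_gibbsMeasure, modifiedPartition_eq]
  have hpt : ∀ σ : V → Spin N, weight G β (toField σ + h)
      = Real.exp (-(β / 2 * energy G h)) * (Real.exp (-(β * dirichletForm G (toField σ) h))
        * weight G β (toField σ)) := by
    intro σ
    rw [weight, weight, ← Real.exp_add, ← Real.exp_add, energy_add]
    congr 1
    ring
  simp only [hpt, integral_const_mul]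
  field_simp

theorem cosh_le_of_sq_le {u : ℝ} (hu : u ^ 2 ≤ 2) : Real.cosh u ≤ 1 + u ^ 2 / 2 + u ^ 4 / 4 := by
  have h1 := Real.cosh_le_exp_half_sq u
  have h2 : |u ^ 2 / 2| ≤ 1 := by
    rw [abs_of_nonneg (by positivity)]
    linarith
  have h3 := (abs_le.1 (Real.abs_exp_sub_one_sub_id_le h2)).2
  nlinarith

/-- Gaussian domination holds as soon as the covariance of the spins is a strict fraction of the
Dirichlet form. -/
theorem gaussianDomination_of_integral_dirichletForm_sq_le (hN : 1 ≤ N) {β δ : ℝ} (hβ : 0 < β)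
    (hδ : 0 < δ)
    (hvar : ∀ v : V → EuclideanSpace ℝ (Fin N),
      β * ∫ σ, dirichletForm G (toField σ) v ^ 2 ∂(gibbsMeasure G N β) ≤ (1 - δ) * energy G v) :
    GaussianDomination G N β := by
  have := isProbabilityMeasure_gibbsMeasure (V := V) G hN β
  obtain ⟨R, hR⟩ := (isCompact_univ (X := V → Spin N)).exists_bound_of_continuousOn
    (continuous_energy_toField G (N := N)).continuousOn
  have hce : Tendsto (fun h : V → EuclideanSpace ℝ (Fin N) => energy G h) (𝓝 0) (𝓝 0) := by
    have h0 : energy G (0 : V → EuclideanSpace ℝ (Fin N)) = 0 := by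
      simpa using energy_smul G (0 : ℝ) (0 : V → EuclideanSpace ℝ (Fin N))
    have := (contDiff_energy G (N := N) (n := 0)).continuous.tendsto 0
    rwa [h0] at this
  have hl1 := hce.const_mul (β ^ 2 * R)
  have hl2 := hce.const_mul (β ^ 4 * R ^ 2 / 4)
  rw [mul_zero] at hl1 hl2
  -- Two conditions on `energy G h` define the neighbourhood: one brings the argument of cosh into
  -- the range of `cosh_le_of_sq_le`, the other lets the gap `δ` pay for the quartic remainder.
  unfold GaussianDomination IsLocalMax IsMaxFilter
  filter_upwards [hl1.eventually (gt_mem_nhds two_pos),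
    hl2.eventually (gt_mem_nhds (show 0 < β * δ / 2 by positivity))] with h h1 h2
  have he := energy_nonneg G h
  have hBsq : ∀ σ : V → Spin N, dirichletForm G (toField σ) h ^ 2 ≤ R * energy G h := by
    intro σ
    have hr : energy G (toField σ) ≤ R := (le_abs_self _).trans (hR σ (Set.mem_univ _))
    exact (dirichletForm_sq_le G _ _).trans (by gcongr)
  have hc := continuous_dirichletForm_toField G h
  have i1 : Integrable (fun σ : V → Spin N => dirichletForm G (toField σ) h ^ 2)
      (gibbsMeasure G N β) := integrable_of_continuous _ (hc.pow 2)
  have hcosh : ∫ σ, Real.cosh (β * dirichletForm G (toField σ) h) ∂(gibbsMeasure G N β)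
      ≤ 1 + β / 2 * energy G h := by
    calc ∫ σ, Real.cosh (β * dirichletForm G (toField σ) h) ∂(gibbsMeasure G N β)
        ≤ ∫ σ, ((1 + β ^ 4 * (R * energy G h) ^ 2 / 4)
            + β ^ 2 / 2 * dirichletForm G (toField σ) h ^ 2) ∂(gibbsMeasure G N β) := by
          refine integral_mono (integrable_of_continuous _ (Real.continuous_cosh.comp
            (continuous_const.mul hc))) ((integrable_const _).add (i1.const_mul _)) fun σ => ?_
          have h3 := hBsq σ
          have h4 : (β * dirichletForm G (toField σ) h) ^ 2 ≤ 2 := by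
            calc (β * dirichletForm G (toField σ) h) ^ 2
                = β ^ 2 * dirichletForm G (toField σ) h ^ 2 := by ring
              _ ≤ β ^ 2 * (R * energy G h) := by gcongr
              _ ≤ 2 := by linarith
          have h5 := cosh_le_of_sq_le h4
          have h6 : (dirichletForm G (toField σ) h ^ 2) ^ 2 ≤ (R * energy G h) ^ 2 := by gcongr
          have h7 : β ^ 4 * (dirichletForm G (toField σ) h ^ 2) ^ 2
              ≤ β ^ 4 * (R * energy G h) ^ 2 := by gcongr
          simp only
          linarith
      _ = 1 + β ^ 4 * (R * energy G h) ^ 2 / 4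
            + β / 2 * (β * ∫ σ, dirichletForm G (toField σ) h ^ 2 ∂(gibbsMeasure G N β)) := by
          rw [integral_add (integrable_const _) (i1.const_mul _), integral_const,
            integral_const_mul]
          simp
          ring
      _ ≤ 1 + β * δ / 2 * energy G h + β / 2 * ((1 - δ) * energy G h) := by
          have h3 := mul_le_mul_of_nonneg_right h2.le he
          have h4 := mul_le_mul_of_nonneg_left (hvar h) (show 0 ≤ β / 2 by positivity)
          linarith
      _ = 1 + β / 2 * energy G h := by ring
  have hexp : 1 + β / 2 * energy G h ≤ Real.exp (β / 2 * energy G h) := by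
    rw [add_comm]
    exact Real.add_one_le_exp _
  have hZ := modifiedPartition_zero_pos G (V := V) hN β
  rw [modifiedPartition_eq_integral_cosh G hN β h]
  calc _ ≤ modifiedPartition G N β 0 * Real.exp (-(β / 2 * energy G h))
        * Real.exp (β / 2 * energy G h) := by
        gcongr
        exact hcosh.trans hexp
    _ = modifiedPartition G N β 0 := by
        rw [mul_assoc, ← Real.exp_add]
        simp

/-- Both sides ignore constants, so `v` may be replaced by `v - v o`, which the Poincaré inequality
bounds by the energy. The covariance error is then at most `1 / (2N)` of the energy, half the
limiting gap `1 / N`, uniformly in `v`. -/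
theorem eventually_integral_dirichletForm_sq_le (hG : G.Connected) (hN : 1 ≤ N) :
    ∀ᶠ β in atTop, ∀ v : V → EuclideanSpace ℝ (Fin N),
      β * ∫ σ, dirichletForm G (toField σ) v ^ 2 ∂(gibbsMeasure G N β)
        ≤ (1 - 1 / (2 * N)) * energy G v := by
  obtain ⟨T, hT, hTb⟩ := exists_tendsto_abs_integral_dirichletForm_sq_sub_le G hG hN
  obtain ⟨C, hC, hCe⟩ := exists_norm_sub_sq_le_energy G hG N
  obtain ⟨o⟩ := hG.nonempty
  have hN0 : (0 : ℝ) < N := by exact_mod_cast hN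
  have hl := hT.mul_const C
  rw [zero_mul] at hl
  filter_upwards [hl.eventually (gt_mem_nhds (show 0 < 1 / (2 * (N : ℝ)) by positivity))]
    with β hβ v
  have h1 := hTb β (C * energy G v) (fun x => v x - v o) (fun x => hCe v x o)
  simp only [dirichletForm_sub_const, energy_sub_const] at h1
  have h2 := (abs_le.1 h1).2
  have h3 := mul_le_mul_of_nonneg_right hβ.le (energy_nonneg G v)
  have h4 : ((N : ℝ) - 1) / N = 1 - 1 / (2 * N) - 1 / (2 * N) := by
    field_simp
    ring
  rw [h4] at h2
  linarith

theorem tendstoUniformlyOn_secondDeriv (hG : G.Connected) (hN : 1 ≤ N) (o : V) :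
    TendstoUniformlyOn
      (fun (β : ℝ) v => secondDeriv G N β v / (β * modifiedPartition G N β 0))
      (fun v => -(1 / (N : ℝ)) * energy G v) atTop (normalizedDirections N o) := by
  obtain ⟨T, hT, hTb⟩ := exists_tendsto_abs_integral_dirichletForm_sq_sub_le G hG hN
  have hN0 : (0 : ℝ) < N := by exact_mod_cast hN
  rw [Metric.tendstoUniformlyOn_iff]
  intro ε hε
  filter_upwards [hT.eventually (gt_mem_nhds hε), eventually_gt_atTop 0] with β h1 hβ v hv
  have hZ := modifiedPartition_zero_pos G (V := V) hN β
  have h2 := hTb β 1 v fun x => by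
    rw [← hv.2]
    exact Finset.single_le_sum (f := fun x => ‖v x‖ ^ 2) (fun i _ => by positivity)
      (Finset.mem_univ x)
  rw [secondDeriv_eq G hN, mul_div_cancel_left₀ _ (by positivity), dist_comm, Real.dist_eq]
  refine lt_of_eq_of_lt (congrArg _ ?_) (h2.trans_lt (by simpa using h1))
  field_simp
  ring

theorem energy_pos_of_mem_normalizedDirections (hG : G.Connected) {o : V}
    {v : V → EuclideanSpace ℝ (Fin N)} (hv : v ∈ normalizedDirections N o) : 0 < energy G v := by
  refine energy_pos G hG ?_
  by_contra! hcon
  have h0 : ∀ x, v x = 0 := fun x => (hcon x o).trans hv.1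
  simpa [h0] using hv.2

end ModifiedPartition

end SpinON

end

theorem theorem4 {V : Type*} [Fintype V] [DecidableEq V] (G : SimpleGraph V)
    [DecidableRel G.Adj] (hG : G.Connected) (N : ℕ) (hN : 1 ≤ N) :
    -- `Z*` is a twice continuously differentiable function of the shift
    (∀ β : ℝ, ContDiff ℝ 2 (SpinON.modifiedPartition G N β)) ∧
    -- Gaussian domination at low temperature, with strictly negative second derivatives
    (∃ βd : ℝ, 0 < βd ∧ ∀ β : ℝ, βd < β →
      SpinON.GaussianDomination G N β ∧
      ∀ v : V → EuclideanSpace ℝ (Fin N), (∃ x y, v x ≠ v y) →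
        SpinON.secondDeriv G N β v < 0) ∧
    -- the limit of the rescaled covariances of the Laplacian of the spins
    (∀ (l : Fin N) (x y : V),
      Tendsto (fun β : ℝ => β * ∫ σ, SpinON.spinLaplacian G σ x l * SpinON.spinLaplacian G σ y l
          ∂(SpinON.gibbsMeasure G N β))
        atTop (𝓝 (((N : ℝ) - 1) / N * G.lapMatrix ℝ x y))) ∧
    -- the uniform limit of the normalized second derivatives, which is strictly negative
    (∀ o : V,
      TendstoUniformlyOn
        (fun (β : ℝ) v =>
          SpinON.secondDeriv G N β v / (β * SpinON.modifiedPartition G N β 0))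
        (fun v => -(1 / (N : ℝ)) * SpinON.energy G v)
        atTop (SpinON.normalizedDirections N o) ∧
      ∀ v ∈ SpinON.normalizedDirections (V := V) N o,
        -(1 / (N : ℝ)) * SpinON.energy G v < 0) := by
  have hN0 : (0 : ℝ) < N := by exact_mod_cast hN
  refine ⟨fun β => SpinON.contDiff_modifiedPartition G β, ?_, fun l x y => ?_, fun o => ⟨?_, ?_⟩⟩
  · obtain ⟨β₀, hβ₀⟩ := eventually_atTop.1
      (SpinON.eventually_integral_dirichletForm_sq_le G hG hN)
    refine ⟨max β₀ 1, by positivity, fun β hβ => ?_⟩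
    have hpos : 0 < β := one_pos.trans_le (le_max_right β₀ 1) |>.trans hβ
    have hvar := hβ₀ β ((le_max_left β₀ 1).trans hβ.le)
    refine ⟨SpinON.gaussianDomination_of_integral_dirichletForm_sq_le G hN hpos
      (by positivity) hvar, fun v hv => ?_⟩
    have he := SpinON.energy_pos G hG hv
    have hZ := SpinON.modifiedPartition_zero_pos G hN β
    have h1 : 0 < 1 / (2 * (N : ℝ)) * SpinON.energy G v := by positivity
    rw [SpinON.secondDeriv_eq G hN]
    refine mul_neg_of_pos_of_neg (by positivity) ?_
    linarith [hvar v]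
  · simp only [SpinON.spinLaplacian_eq]
    exact SpinON.tendsto_mul_integral_lap_mul_lap G hG hN l x y
  · exact SpinON.tendstoUniformlyOn_secondDeriv G hG hN o
  · intro v hv
    have he := SpinON.energy_pos_of_mem_normalizedDirections G hG hv
    have h1 : 0 < 1 / (N : ℝ) * SpinON.energy G v := by positivity
    linarith
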